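/- Let $\Delta\subset\mathbb C$ be the open unit disk and, for an integer $p\ge 2$, let $\Delta^p\subset\mathbb C^p$ be the open unit polydisk. For a bounded domain $U$ let $ds_U^2$ denote its Bergman metric, i.e. the Hermitian metric with coefficients $\partial^2\log K_U(z,z)/\partial z_i\partial\overline{z_j}$, where $K_U$ is the Bergman kernel of $U$. Let $\varsigma:(\mathbb P^1)^p\hookrightarrow\mathbb P^{2^p-1}$ be the Segre embedding and let $\varrho:\mathbb C^p\to\mathbb P^{2^p-1}$, $\varrho(z_1,\ldots,z_p)=\varsigma([1,z_1],\ldots,[1,z_p])$, be its restriction to $\mathbb C^p\subset(\mathbb P^1)^p$. Proposition 3.8. Let $f:(\Delta,2\,ds_\Delta^2)\to(\Delta^p,ds_{\Delta^p}^2)$ be a holomorphic isometry, i.e. a holomorphic map $f:\Delta\to\Delta^p$ with $f^*ds_{\Delta^p}^2=2\,ds_\Delta^2$. Then there exist an affine-algebraic subvariety $\mathscr V\subset\mathbb C^p$ and a projective linear subspace $P\subseteq\mathbb P^{2^p-1}$ such that $f(\Delta)$ is an irreducible component of the complex-analytic subset $\mathscr V\cap\Delta^p$ of $\Delta^p$ and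 $$\varrho(\mathscr V\cap\Delta^p)=\varrho(\Delta^p)\cap P .$$ -/

import Mathlib

open MeasureTheory Set
open scoped LinearAlgebra.Projectivization

/-! ### The Bergman metric and holomorphic isometries -/

/-- The Bergman kernel of a domain `U` on the diagonal,
`K_U(z, z) = sup { |φ(z)|² : φ holomorphic on U, ∫_U |φ|² ≤ 1 }`
(equivalently `∑ |φ_i(z)|²` for an orthonormal basis `(φ_i)` of the space of square-integrable
holomorphic functions). For bounded `U` and `z ∈ U` the supremum is finite. -/
noncomputable def bergmanKernel {E : Type*} [NormedAddCommGroup E] [NormedSpace ℂ E]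
    [MeasureSpace E] (U : Set E) (z : E) : ℝ :=
  sSup {r : ℝ | ∃ φ : E → ℂ, DifferentiableOn ℂ φ U ∧ ∫⁻ x in U, ‖φ x‖ₑ ^ 2 ≤ 1 ∧ r = ‖φ z‖ ^ 2}

/-- The Bergman metric `ds²_U`, as the quadratic form
`∑ ∂²(log K_U)/∂z_i∂z̄_j (z) v_i v̄_j` on tangent vectors `v` at `z`. On the complex line
`t ↦ z + t v` this is `∂²/∂t∂t̄` at `t = 0`, that is, one quarter of the Laplacian in `t`. -/
noncomputable def bergmanMetric {E : Type*} [NormedAddCommGroup E] [NormedSpace ℂ E]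
    [MeasureSpace E] (U : Set E) (z v : E) : ℝ :=
  (1 / 4) * Laplacian.laplacian (fun t : ℂ => Real.log (bergmanKernel U (z + t • v))) 0

/-- `f : (U, k ds²_U) → (V, ds²_V)` is a holomorphic isometry: `f` is a holomorphic map from `U`
to `V` with `f^* ds²_V = k ds²_U`. (A Hermitian form is determined by its quadratic form.) -/
def IsHolomorphicIsometry {E F : Type*}
    [NormedAddCommGroup E] [NormedSpace ℂ E] [MeasureSpace E]
    [NormedAddCommGroup F] [NormedSpace ℂ F] [MeasureSpace F]
    (k : ℝ) (U : Set E) (V : Set F) (f : E → F) : Prop :=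
  MapsTo f U V ∧ DifferentiableOn ℂ f U ∧
    ∀ z ∈ U, ∀ v : E, bergmanMetric V (f z) (fderiv ℂ f z v) = k * bergmanMetric U z v

/-- The open unit disk `Δ` in `ℂ`. -/
def unitDisk : Set ℂ := {z | ‖z‖ < 1}

/-- The open unit polydisk `Δ^p` in `ℂ^p`. -/
def polydisk (p : ℕ) : Set (Fin p → ℂ) := {z | ∀ j, ‖z j‖ < 1}

/-! ### Irreducible components of analytic sets -/

/-- The regular points of `A`: those near which `A` is a complex submanifold (of some dimension),
i.e. the zero set of a holomorphic map to some `ℂ^k` that is a submersion at the point. -/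
def regularLocus {E : Type*} [NormedAddCommGroup E] [NormedSpace ℂ E] (A : Set E) : Set E :=
  {x | x ∈ A ∧ ∃ (k : ℕ) (W : Set E) (g : E → Fin k → ℂ), IsOpen W ∧ x ∈ W ∧
    DifferentiableOn ℂ g W ∧ Function.Surjective (fderiv ℂ g x) ∧ A ∩ W = {y ∈ W | g y = 0}}

/-- `S` is an irreducible component of the complex-analytic subset `A` of the open set `Ω`: it is
the closure in `Ω` of a connected component of the complex manifold of regular points of `A`. -/
def IsIrreducibleComponent {E : Type*} [NormedAddCommGroup E] [NormedSpace ℂ E]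
    (Ω A S : Set E) : Prop :=
  ∃ x ∈ regularLocus A, S = closure (connectedComponentIn (regularLocus A) x) ∩ Ω

/-- An affine-algebraic subvariety of `ℂ^p` (not necessarily irreducible): the set of common zeros
of an ideal of polynomials. -/
def IsAffineAlgebraic {p : ℕ} (V : Set (Fin p → ℂ)) : Prop :=
  ∃ I : Ideal (MvPolynomial (Fin p) ℂ), V = MvPolynomial.zeroLocus ℂ I

/-! ### The Segre embedding -/

/-- The products of coordinates that make up the Segre embedding. -/
def segreVec {p : ℕ} (v : Fin p → Fin 2 → ℂ) : (Fin p → Fin 2) → ℂ :=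
  fun ε => ∏ j, v j (ε j)

theorem segreVec_ne_zero {p : ℕ} (v : Fin p → Fin 2 → ℂ) (hv : ∀ j, v j ≠ 0) :
    segreVec v ≠ 0 := by
  choose ε hε using fun j => Function.ne_iff.mp (hv j)
  exact fun h => Finset.prod_ne_zero_iff.mpr (fun j _ => hε j) (congrFun h ε)

/-- The Segre embedding `ς : (ℙ¹)^p → ℙ^{2^p - 1}`; the `2^p` homogeneous coordinates of the target
are indexed by `Fin p → Fin 2`. -/
noncomputable def segre {p : ℕ} (x : Fin p → ℙ ℂ (Fin 2 → ℂ)) : ℙ ℂ ((Fin p → Fin 2) → ℂ) :=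
  Projectivization.mk ℂ (segreVec fun j => (x j).rep)
    (segreVec_ne_zero _ fun j => (x j).rep_nonzero)

/-- The Segre embedding does not depend on the choice of homogeneous coordinates. -/
theorem segre_mk {p : ℕ} (v : Fin p → Fin 2 → ℂ) (hv : ∀ j, v j ≠ 0) :
    segre (fun j => Projectivization.mk ℂ (v j) (hv j)) =
      Projectivization.mk ℂ (segreVec v) (segreVec_ne_zero v hv) := by
  choose a ha using fun j => Projectivization.exists_smul_eq_mk_rep ℂ (v j) (hv j)
  rw [segre, Projectivization.mk_eq_mk_iff']
  refine ⟨∏ j, (a j : ℂ), ?_⟩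
  funext ε
  simp [segreVec, ← ha, Finset.prod_mul_distrib, Units.smul_def]

theorem one_coord_ne_zero (z : ℂ) : (![1, z] : Fin 2 → ℂ) ≠ 0 :=
  fun h => one_ne_zero (congrFun h 0)

/-- The restriction `ϱ` of the Segre embedding to `ℂ^p ⊂ (ℙ¹)^p`,
`ϱ(z₁, …, z_p) = ς([1, z₁], …, [1, z_p])`. -/
noncomputable def segreAffine {p : ℕ} (z : Fin p → ℂ) : ℙ ℂ ((Fin p → Fin 2) → ℂ) :=
  segre fun j => Projectivization.mk ℂ ![1, z j] (one_coord_ne_zero (z j))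

/-! ### The Bergman kernel of a balanced domain and its behaviour under involutions -/

/-! Moving a point to the origin by coordinatewise disk involutions shows that the Bergman kernel of
the polydisk is a constant times `∏ (1 - |z_j|²)⁻²`. The isometry condition then says that `∑ log (1
- |f_j|²) - 2 log (1 - |z|²)` is harmonic on the disk, hence the real part of a holomorphic
function. Exponentiating and polarizing gives a nowhere zero holomorphic `H` with `∏ (1 - f_j(z)
conj f_j(w)) = H(z) conj H(w) (1 - z conj w)²` (`exists_segreForm_eq`).

The left side is a Hermitian form on `ℂ^{2^p}` evaluated at the lifts `⊗ (1, f_j)`. Since `(1 - z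
conj w)² = 1 - 2 z conj w + z² conj w²` has a single minus sign, that form has negative index at
most one on the span `M` of the lifts of `f(Δ)`. Take `P = ℙ(M)` and let `V` consist of the points
whose lift lies in `M`.

At a point of `Δ^p` the form is negative definite on the tangent directions of the Segre variety,
once these are made orthogonal to the lift. So the Zariski tangent spaces defined by the linear
equations of `M` have dimension at most one on `V ∩ Δ^p` (`exists_tangent_dependent`). As `f' ≠ 0`,
the section is a smooth curve near each point of `f(Δ)` and agrees there with `f(Δ)`
(`exists_chart`). The functional equation also makes `f` proper (`closure_image_inter`). Thus `f(Δ)`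
is connected, open in `V ∩ Δ^p` and closed in `Δ^p`, which makes it an irreducible component. -/

theorem abs_det_restrictScalars {E : Type*} [NormedAddCommGroup E] [NormedSpace ℂ E]
    (L : E →L[ℂ] E) : |(L.restrictScalars ℝ).det| = ‖L.det‖ ^ 2 := by
  have h : (L.restrictScalars ℝ).det = Algebra.norm ℝ L.det :=
    LinearMap.det_restrictScalars (R := ℝ) (f := (L : E →ₗ[ℂ] E))
  rw [h, Algebra.norm_complex_apply, Complex.normSq_eq_norm_sq, abs_of_nonneg (by positivity)]

section Kernel

variable {E : Type*} [NormedAddCommGroup E] [NormedSpace ℂ E]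
  [FiniteDimensional ℂ E] [MeasureSpace E] [BorelSpace E]
  [(volume : Measure E).IsAddHaarMeasure]

/-- The real Jacobian of a holomorphic map is the squared modulus of its complex Jacobian
determinant. -/
theorem lintegral_image_complex {s : Set E} (hs : MeasurableSet s) {Φ : E → E}
    {Φ' : E → E →L[ℂ] E} (hΦ : ∀ x ∈ s, HasFDerivAt Φ (Φ' x) x) (hinj : InjOn Φ s)
    (g : E → ENNReal) :
    ∫⁻ x in Φ '' s, g x = ∫⁻ x in s, ‖(Φ' x).det‖ₑ ^ 2 * g (Φ x) := by
  have : FiniteDimensional ℝ E := FiniteDimensional.complexToReal E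
  rw [lintegral_image_eq_lintegral_abs_det_fderiv_mul volume hs
    (f' := fun x => (Φ' x).restrictScalars ℝ)
    (fun x hx => ((hΦ x hx).restrictScalars ℝ).hasFDerivWithinAt) hinj]
  refine lintegral_congr fun x => ?_
  rw [abs_det_restrictScalars, ENNReal.ofReal_pow (norm_nonneg _), ofReal_norm]

open scoped Pointwise in
/-- Transformation rule of the Bergman kernel under a holomorphic involution. -/
theorem bergmanKernel_involution {U : Set E} (hU : IsOpen U) {Φ : E → E}
    {Φ' : E → E →L[ℂ] E} (hΦ : ∀ x ∈ U, HasFDerivAt Φ (Φ' x) x) (hmaps : MapsTo Φ U U)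
    (hinv : ∀ x ∈ U, Φ (Φ x) = x) (hJ : DifferentiableOn ℂ (fun x => (Φ' x).det) U)
    {z : E} (hz : z ∈ U) :
    bergmanKernel U z = ‖(Φ' z).det‖ ^ 2 * bergmanKernel U (Φ z) := by
  have hinj : InjOn Φ U := fun x hx y hy h => by rw [← hinv x hx, h, hinv y hy]
  have himg : Φ '' U = U := by
    refine Subset.antisymm hmaps.image_subset fun x hx => ⟨Φ x, hmaps hx, hinv x hx⟩
  have hdet : ∀ x ∈ U, (Φ' (Φ x)).det * (Φ' x).det = 1 := by
    intro x hx
    have h1 : HasFDerivAt (Φ ∘ Φ) ((Φ' (Φ x)).comp (Φ' x)) x :=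
      (hΦ _ (hmaps hx)).comp x (hΦ x hx)
    have h2 : HasFDerivAt (Φ ∘ Φ) (ContinuousLinearMap.id ℂ E) x :=
      (hasFDerivAt_id x).congr_of_eventuallyEq
        (Filter.eventually_of_mem (hU.mem_nhds hx) fun y hy => hinv y hy)
    have h3 := h1.unique h2
    have h4 := congrArg (fun L : E →L[ℂ] E => LinearMap.det (L : E →ₗ[ℂ] E)) h3
    simpa [LinearMap.det_comp] using h4
  set S : E → Set ℝ := fun z => {r : ℝ | ∃ φ : E → ℂ, DifferentiableOn ℂ φ U ∧
    ∫⁻ x in U, ‖φ x‖ₑ ^ 2 ≤ 1 ∧ r = ‖φ z‖ ^ 2} with hS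
  -- The pullback `φ ↦ det Φ' · (φ ∘ Φ)` keeps the `L²` norm, by change of variables, and stays
  -- holomorphic by `hJ`.
  have key : ∀ x ∈ U, ∀ r ∈ S (Φ x), ‖(Φ' x).det‖ ^ 2 * r ∈ S x := by
    rintro x hx r ⟨φ, hφ, hint, rfl⟩
    refine ⟨fun y => (Φ' y).det * φ (Φ y), hJ.mul (hφ.comp
      (fun y hy => (hΦ y hy).differentiableAt.differentiableWithinAt) hmaps), ?_, ?_⟩
    · rw [← himg, lintegral_image_complex hU.measurableSet hΦ hinj] at hint
      simpa [enorm_mul, mul_pow] using hint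
    · rw [norm_mul, mul_pow]
  have hSz : S z = ‖(Φ' z).det‖ ^ 2 • S (Φ z) := by
    ext r
    rw [Set.mem_smul_set]
    constructor
    · intro hr
      -- The reverse inclusion is `key` at `Φ z`; the two Jacobians are inverse to each other
      -- because `Φ` is an involution.
      refine ⟨‖(Φ' (Φ z)).det‖ ^ 2 * r, key _ (hmaps hz) r (by rwa [hinv z hz]), ?_⟩
      rw [smul_eq_mul, ← mul_assoc, ← mul_pow, ← norm_mul, mul_comm, mul_comm (Φ' z).det,
        hdet z hz]
      simp
    · rintro ⟨s, hs, rfl⟩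
      exact key z hz s hs
  change sSup (S z) = _ * sSup (S (Φ z))
  rw [hSz, Real.sSup_smul_of_nonneg (by positivity), smul_eq_mul]

theorem lintegral_rotation {U : Set E} (hU : IsOpen U)
    (hbal : ∀ c : ℂ, ‖c‖ ≤ 1 → ∀ x ∈ U, c • x ∈ U) {c : ℂ} (hc : ‖c‖ = 1) (g : E → ENNReal) :
    ∫⁻ x in U, g (c • x) = ∫⁻ x in U, g x := by
  have hc0 : c ≠ 0 := by rintro rfl; simp at hc
  have himg : (fun x : E => c • x) '' U = U := by
    refine Subset.antisymm (image_subset_iff.2 fun x hx => hbal c hc.le x hx) fun x hx =>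
      ⟨c⁻¹ • x, hbal _ (by simp [hc]) x hx, by simp [smul_smul, hc0]⟩
  conv_rhs => rw [← himg]
  rw [lintegral_image_complex (Φ := fun x : E => c • x)
    (Φ' := fun _ => c • ContinuousLinearMap.id ℂ E) hU.measurableSet
    (fun x _ => (hasFDerivAt_id x).const_smul c) (fun x _ y _ h => smul_right_injective E hc0 h)]
  refine lintegral_congr fun x => ?_
  have : ‖(c • ContinuousLinearMap.id ℂ E).det‖ₑ = 1 := by
    rw [← ofReal_norm]
    simp [ContinuousLinearMap.det, LinearMap.det_smul, hc]
  rw [this]; simp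

/-- Mean value inequality on a balanced open set. -/
theorem volume_mul_enorm_sq_le {U : Set E} (hU : IsOpen U)
    (hbal : ∀ c : ℂ, ‖c‖ ≤ 1 → ∀ x ∈ U, c • x ∈ U) {φ : E → ℂ} (hφ : DifferentiableOn ℂ φ U) :
    volume U * ‖φ 0‖ₑ ^ 2 ≤ ∫⁻ x in U, ‖φ x‖ₑ ^ 2 := by
  have : FiniteDimensional ℝ E := FiniteDimensional.complexToReal E
  set ν : Measure ℝ := volume.restrict (Set.uIoc 0 (2 * Real.pi)) with hν
  have hνu : ν univ = ENNReal.ofReal (2 * Real.pi) := by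
    rw [hν, Measure.restrict_apply_univ, uIoc_of_le Real.two_pi_pos.le, Real.volume_Ioc, sub_zero]
  -- Mean value property on the complex line through `x`. Applying it to `φ²` rather than `φ` yields
  -- `|φ|²` without Cauchy–Schwarz.
  have hpt : ∀ x ∈ U, ENNReal.ofReal (2 * Real.pi) * ‖φ 0‖ₑ ^ 2 ≤
      ∫⁻ θ, ‖φ (circleMap 0 1 θ • x)‖ₑ ^ 2 ∂ν := by
    intro x hx
    have hd : DiffContOnCl ℂ (fun t : ℂ => φ (t • x) ^ 2) (Metric.ball 0 |1|) := by
      refine DifferentiableOn.diffContOnCl_ball (U := {t : ℂ | t • x ∈ U}) ?_ ?_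
      · have h1 : DifferentiableOn ℂ (fun t : ℂ => φ (t • x)) {t : ℂ | t • x ∈ U} :=
          hφ.comp (differentiable_id.smul_const x).differentiableOn fun t ht => ht
        exact h1.pow 2
      · intro t ht
        exact hbal t (by simpa using ht) x hx
    have h1 := hd.circleAverage
    rw [Real.circleAverage_def] at h1
    simp only [zero_smul] at h1
    have h2 : (2 * Real.pi) • φ 0 ^ 2 =
        ∫ θ in (0 : ℝ)..2 * Real.pi, φ (circleMap 0 1 θ • x) ^ 2 := by
      rw [← h1, smul_smul, mul_inv_cancel₀ Real.two_pi_pos.ne', one_smul]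
    calc ENNReal.ofReal (2 * Real.pi) * ‖φ 0‖ₑ ^ 2
        = ‖(2 * Real.pi) • φ 0 ^ 2‖ₑ := by
          rw [enorm_smul, enorm_pow, Real.enorm_of_nonneg Real.two_pi_pos.le]
      _ ≤ _ := by
          rw [h2, intervalIntegral.integral_of_le Real.two_pi_pos.le,
            ← uIoc_of_le Real.two_pi_pos.le]
          refine (enorm_integral_le_lintegral_enorm _).trans (le_of_eq ?_)
          simp only [enorm_pow]; rfl
  have hcirc : ∀ θ, ‖circleMap 0 1 θ‖ = 1 := fun θ => by simp
  have hmeas : AEMeasurable (Function.uncurry fun (x : E) (θ : ℝ) =>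
      ‖φ (circleMap 0 1 θ • x)‖ₑ ^ 2) ((volume.restrict U).prod ν) := by
    have : (volume.restrict U).prod ν =
        (volume.prod volume).restrict (U ×ˢ Set.uIoc 0 (2 * Real.pi)) :=
      Measure.prod_restrict _ _
    rw [this]
    refine ContinuousOn.aemeasurable ?_ (hU.measurableSet.prod measurableSet_uIoc)
    have hc : Continuous fun q : E × ℝ => circleMap 0 1 q.2 • q.1 :=
      ((continuous_circleMap 0 1).comp continuous_snd).smul continuous_fst
    exact (ENNReal.continuous_pow 2).comp_continuousOn (hφ.continuousOn.comp hc.continuousOn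
      fun q hq => hbal _ (hcirc q.2).le _ hq.1).enorm
  have h3 : ∫⁻ _ in U, ENNReal.ofReal (2 * Real.pi) * ‖φ 0‖ₑ ^ 2 ≤
      ∫⁻ x in U, ∫⁻ θ, ‖φ (circleMap 0 1 θ • x)‖ₑ ^ 2 ∂ν :=
    setLIntegral_mono' hU.measurableSet hpt
  -- After the swap, every inner integral over `U` is independent of `θ` by rotation invariance.
  rw [lintegral_lintegral_swap hmeas] at h3
  simp only [lintegral_rotation hU hbal (hcirc _) (fun x => ‖φ x‖ₑ ^ 2), lintegral_const, hνu,
    Measure.restrict_apply_univ] at h3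
  have hpi0 : ENNReal.ofReal (2 * Real.pi) ≠ 0 := by
    simpa using Real.pi_pos
  rw [mul_assoc, mul_comm (∫⁻ x in U, _), ENNReal.mul_le_mul_iff_right hpi0 ENNReal.ofReal_ne_top,
    mul_comm] at h3
  exact h3

/-- The kernel at the center is `1 / vol U`: a normalized constant attains it and the mean value
inequality bounds every competitor. The bound cannot be skipped, since the real `sSup` of an
unbounded set is `0`. -/
theorem bergmanKernel_zero_pos {U : Set E} (hU : IsOpen U) (h0 : (0 : E) ∈ U)
    (hbal : ∀ c : ℂ, ‖c‖ ≤ 1 → ∀ x ∈ U, c • x ∈ U) (hb : Bornology.IsBounded U) :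
    0 < bergmanKernel U 0 := by
  have : FiniteDimensional ℝ E := FiniteDimensional.complexToReal E
  have : ProperSpace E := FiniteDimensional.proper ℂ E
  have hpos : volume U ≠ 0 := (hU.measure_pos volume ⟨0, h0⟩).ne'
  have htop : volume U ≠ ⊤ := hb.measure_lt_top.ne
  set v := (volume U).toReal with hv
  have hvpos : 0 < v := ENNReal.toReal_pos hpos htop
  have hvol : volume U = ENNReal.ofReal v := (ENNReal.ofReal_toReal htop).symm
  refine lt_of_lt_of_le (b := v⁻¹) (by positivity) ?_
  refine le_csSup ⟨v⁻¹, ?_⟩ ?_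
  · rintro r ⟨φ, hφ, hint, rfl⟩
    have h := (volume_mul_enorm_sq_le hU hbal hφ).trans hint
    rw [hvol, ← ofReal_norm, ← ENNReal.ofReal_pow (norm_nonneg _),
      ← ENNReal.ofReal_mul hvpos.le, ← ENNReal.ofReal_one,
      ENNReal.ofReal_le_ofReal_iff zero_le_one] at h
    rw [← one_div, le_div_iff₀ hvpos, mul_comm]
    exact h
  · refine ⟨fun _ => ((√(v⁻¹) : ℝ) : ℂ), differentiableOn_const _, ?_, ?_⟩
    · rw [lintegral_const, Measure.restrict_apply_univ, hvol, ← ofReal_norm,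
        ← ENNReal.ofReal_pow (norm_nonneg _), ← ENNReal.ofReal_mul (by positivity)]
      simp [abs_of_nonneg, Real.sq_sqrt, hvpos.le, hvpos.ne']
    · simp [Real.sq_sqrt, hvpos.le]

end Kernel

/-! ### The Bergman kernels of the disk and of the polydisk -/

open scoped ComplexConjugate in
/-- The holomorphic involution of the unit disk that exchanges `0` and `a`. -/
noncomputable def diskInvolution (a z : ℂ) : ℂ := (a - z) / (1 - conj a * z)

open scoped ComplexConjugate in
/-- The derivative of `diskInvolution a`. -/
noncomputable def diskInvolutionDeriv (a z : ℂ) : ℂ := (conj a * a - 1) / (1 - conj a * z) ^ 2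

section Involution

open scoped ComplexConjugate

variable {a z : ℂ}

theorem one_sub_conj_mul_ne_zero (ha : ‖a‖ < 1) (hz : ‖z‖ < 1) : 1 - conj a * z ≠ 0 := by
  intro h
  have h1 : conj a * z = 1 := (sub_eq_zero.1 h).symm
  have h2 : ‖conj a * z‖ < 1 := by
    rw [norm_mul, RCLike.norm_conj]
    exact mul_lt_one_of_nonneg_of_lt_one_left (norm_nonneg _) ha hz.le
  rw [h1] at h2
  simp at h2

theorem hasDerivAt_diskInvolution (ha : ‖a‖ < 1) (hz : ‖z‖ < 1) :
    HasDerivAt (diskInvolution a) (diskInvolutionDeriv a z) z := by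
  have hne := one_sub_conj_mul_ne_zero ha hz
  have h := ((hasDerivAt_id z).const_sub a).div
    (((hasDerivAt_id z).const_mul (conj a)).const_sub 1) hne
  have e : diskInvolutionDeriv a z = ((-1) * (1 - conj a * z) - (a - z) * -(conj a * 1)) /
      (1 - conj a * z) ^ 2 := by
    unfold diskInvolutionDeriv
    congr 1
    ring
  rw [e]
  exact h

/-- This rests on `|1 - conj a z|² - |a - z|² = (1 - |a|²)(1 - |z|²)`. -/
theorem norm_diskInvolution_lt_one (ha : ‖a‖ < 1) (hz : ‖z‖ < 1) : ‖diskInvolution a z‖ < 1 := by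
  have hne := one_sub_conj_mul_ne_zero ha hz
  rw [diskInvolution, norm_div, div_lt_one (norm_pos_iff.2 hne)]
  refine lt_of_pow_lt_pow_left₀ 2 (norm_nonneg _) ?_
  have ha' : ‖a‖ ^ 2 < 1 := by nlinarith [norm_nonneg a]
  have hz' : ‖z‖ ^ 2 < 1 := by nlinarith [norm_nonneg z]
  rw [← Complex.normSq_eq_norm_sq, Complex.normSq_apply] at ha' hz' ⊢
  rw [← Complex.normSq_eq_norm_sq, Complex.normSq_apply]
  simp only [Complex.sub_re, Complex.sub_im, Complex.mul_re, Complex.mul_im, Complex.conj_re,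
    Complex.conj_im, Complex.one_re, Complex.one_im]
  nlinarith [mul_pos (sub_pos.2 ha') (sub_pos.2 hz')]

theorem one_sub_conj_mul_self_ne_zero (ha : ‖a‖ < 1) : 1 - conj a * a ≠ 0 :=
  one_sub_conj_mul_ne_zero ha ha

theorem diskInvolution_diskInvolution (ha : ‖a‖ < 1) (hz : ‖z‖ < 1) :
    diskInvolution a (diskInvolution a z) = z := by
  have hne := one_sub_conj_mul_ne_zero ha hz
  have hne' := one_sub_conj_mul_ne_zero ha (norm_diskInvolution_lt_one ha hz)
  have key : (1 - conj a * z) * diskInvolution a z = a - z := by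
    rw [diskInvolution, mul_div_cancel₀ _ hne]
  rw [diskInvolution, div_eq_iff hne']
  refine mul_left_cancel₀ hne ?_
  linear_combination (conj a * z - 1) * key

theorem diskInvolution_self (a : ℂ) : diskInvolution a a = 0 := by simp [diskInvolution]

theorem differentiableOn_diskInvolutionDeriv (ha : ‖a‖ < 1) :
    DifferentiableOn ℂ (diskInvolutionDeriv a) unitDisk := by
  intro z hz
  have hne := one_sub_conj_mul_ne_zero ha hz
  refine DifferentiableAt.differentiableWithinAt ?_
  unfold diskInvolutionDeriv
  exact (differentiableAt_const _).div (by fun_prop) (pow_ne_zero 2 hne)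

theorem conj_mul_self_eq (a : ℂ) : conj a * a = ((‖a‖ ^ 2 : ℝ) : ℂ) := by
  rw [mul_comm, Complex.mul_conj, Complex.normSq_eq_norm_sq]

theorem one_sub_norm_sq_pos (ha : ‖a‖ < 1) : 0 < 1 - ‖a‖ ^ 2 := by
  nlinarith [norm_nonneg a]

theorem norm_diskInvolutionDeriv_self (ha : ‖a‖ < 1) :
    ‖diskInvolutionDeriv a a‖ = (1 - ‖a‖ ^ 2)⁻¹ := by
  have h := one_sub_norm_sq_pos ha
  have h1 : diskInvolutionDeriv a a = -(((1 - ‖a‖ ^ 2)⁻¹ : ℝ) : ℂ) := by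
    have hne := one_sub_conj_mul_self_ne_zero ha
    rw [diskInvolutionDeriv]
    push_cast
    rw [conj_mul_self_eq] at hne ⊢
    push_cast at hne ⊢
    field_simp
    ring
  rw [h1, norm_neg, Complex.norm_real, Real.norm_of_nonneg (inv_nonneg.2 h.le)]

end Involution

theorem isOpen_unitDisk : IsOpen unitDisk := isOpen_lt continuous_norm continuous_const

theorem unitDisk_eq_ball : unitDisk = Metric.ball 0 1 := by
  ext z; simp [unitDisk]

theorem polydisk_eq_ball (p : ℕ) : polydisk p = Metric.ball 0 1 := by
  ext z; simp [polydisk, pi_norm_lt_iff]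

theorem isOpen_polydisk (p : ℕ) : IsOpen (polydisk p) := by
  rw [polydisk_eq_ball]; exact Metric.isOpen_ball

theorem bergmanKernel_unitDisk {a : ℂ} (ha : a ∈ unitDisk) :
    bergmanKernel unitDisk a = ((1 - ‖a‖ ^ 2)⁻¹) ^ 2 * bergmanKernel unitDisk 0 := by
  have h := bergmanKernel_involution isOpen_unitDisk (Φ := diskInvolution a)
    (Φ' := fun z => ContinuousLinearMap.toSpanSingleton ℂ (diskInvolutionDeriv a z))
    (fun z hz => (hasDerivAt_diskInvolution ha hz).hasFDerivAt)
    (fun z hz => norm_diskInvolution_lt_one ha hz)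
    (fun z hz => diskInvolution_diskInvolution ha hz)
    (by simpa only [ContinuousLinearMap.det_toSpanSingleton]
        using differentiableOn_diskInvolutionDeriv ha) ha
  rwa [ContinuousLinearMap.det_toSpanSingleton, diskInvolution_self,
    norm_diskInvolutionDeriv_self ha] at h

theorem bergmanKernel_unitDisk_zero_pos : 0 < bergmanKernel unitDisk 0 := by
  refine bergmanKernel_zero_pos isOpen_unitDisk (by simp [unitDisk]) (fun c hc x hx => ?_) ?_
  · have hx' : ‖x‖ < 1 := hx
    change ‖c • x‖ < 1
    rw [norm_smul]
    exact (mul_le_of_le_one_left (norm_nonneg _) hc).trans_lt hx'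
  · rw [unitDisk_eq_ball]; exact Metric.isBounded_ball

/-- The coordinatewise involution sends `a` to `0` and has a diagonal differential, so its Jacobian
is the product of the one-variable derivatives. -/
theorem bergmanKernel_polydisk {p : ℕ} {a : Fin p → ℂ} (ha : a ∈ polydisk p) :
    bergmanKernel (polydisk p) a =
      (∏ j, (1 - ‖a j‖ ^ 2)⁻¹) ^ 2 * bergmanKernel (polydisk p) 0 := by
  have hdet : ∀ z : Fin p → ℂ, (ContinuousLinearMap.pi fun j =>
      (ContinuousLinearMap.toSpanSingleton ℂ (diskInvolutionDeriv (a j) (z j))).comp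
        (ContinuousLinearMap.proj (R := ℂ) (φ := fun _ : Fin p => ℂ) j)).det =
      ∏ j, diskInvolutionDeriv (a j) (z j) := by
    intro z
    rw [ContinuousLinearMap.det_pi]
    simp only [ContinuousLinearMap.det_toSpanSingleton]
  have h := bergmanKernel_involution (isOpen_polydisk p)
    (Φ := fun z j => diskInvolution (a j) (z j))
    (Φ' := fun z => ContinuousLinearMap.pi fun j =>
      (ContinuousLinearMap.toSpanSingleton ℂ (diskInvolutionDeriv (a j) (z j))).comp
        (ContinuousLinearMap.proj j))
    (fun z hz => hasFDerivAt_pi.2 fun j =>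
      HasFDerivAt.comp (f := fun w : Fin p → ℂ => w j) z
        (hasDerivAt_diskInvolution (ha j) (hz j)).hasFDerivAt (hasFDerivAt_apply j z))
    (fun z hz j => norm_diskInvolution_lt_one (ha j) (hz j))
    (fun z hz => funext fun j => diskInvolution_diskInvolution (ha j) (hz j))
    (by
      simp only [hdet]
      intro z hz
      refine (HasFDerivWithinAt.finsetProd fun j _ =>
        DifferentiableWithinAt.hasFDerivWithinAt ?_).differentiableWithinAt
      exact ((differentiableOn_diskInvolutionDeriv (ha j)).comp (s := polydisk p) (t := unitDisk)
        (f := fun w : Fin p → ℂ => w j) (differentiable_apply j).differentiableOn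
        fun w hw => hw j) z hz) ha
  have hz : (fun j => diskInvolution (a j) (a j)) = 0 := funext fun j => diskInvolution_self _
  rw [hdet, norm_prod, hz] at h
  simpa only [norm_diskInvolutionDeriv_self (ha _)] using h

theorem bergmanKernel_polydisk_zero_pos (p : ℕ) : 0 < bergmanKernel (polydisk p) 0 := by
  refine bergmanKernel_zero_pos (isOpen_polydisk p) (by simp [polydisk])
    (fun c hc x hx j => ?_) ?_
  · rw [Pi.smul_apply, norm_smul]
    exact (mul_le_of_le_one_left (norm_nonneg _) hc).trans_lt (hx j)
  · rw [polydisk_eq_ball]; exact Metric.isBounded_ball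

/-! ### The Bergman metrics of the disk and of the polydisk -/

section Metric

open scoped ComplexConjugate Topology Laplacian

theorem hasDerivAt_log_one_sub_norm_sq {c : ℝ → ℂ} {c' : ℂ} {s : ℝ} (hc : HasDerivAt c c' s)
    (h1 : ‖c s‖ < 1) :
    HasDerivAt (fun s => Real.log (1 - ‖c s‖ ^ 2))
      (-(2 * (conj (c s) * c').re) / (1 - ‖c s‖ ^ 2)) s := by
  have h := (hc.norm_sq.const_sub 1).log (one_sub_norm_sq_pos h1).ne'
  rwa [Complex.inner, mul_comm c'] at h

theorem contDiffAt_log_one_sub_norm_sq {g : ℂ → ℂ} {z : ℂ} (hg : AnalyticAt ℂ g z)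
    (h1 : ‖g z‖ < 1) : ContDiffAt ℝ 2 (fun w => Real.log (1 - ‖g w‖ ^ 2)) z := by
  have hgR : ContDiffAt ℝ 2 g z := (hg.contDiffAt (n := 2)).restrict_scalars ℝ
  exact ContDiffAt.log (contDiffAt_const.sub (hgR.norm_sq ℝ)) (one_sub_norm_sq_pos h1).ne'

theorem hasDerivAt_comp_line {g : ℂ → ℂ} {w d : ℂ} (hg : HasDerivAt g d w) (e : ℂ) :
    HasDerivAt (fun s : ℝ => g (w + s • e)) (d * e) 0 := by
  have hl : HasDerivAt (fun s : ℝ => w + s • e) e 0 := by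
    simpa using ((hasDerivAt_id (0 : ℝ)).smul_const e).const_add w
  have hg' : HasDerivAt g d (w + (0 : ℝ) • e) := by simpa using hg
  exact hg'.comp (0 : ℝ) hl

theorem fderiv_log_one_sub_norm_sq {g : ℂ → ℂ} {w : ℂ} (hg : AnalyticAt ℂ g w)
    (h1 : ‖g w‖ < 1) (e : ℂ) :
    fderiv ℝ (fun w => Real.log (1 - ‖g w‖ ^ 2)) w e =
      -(2 * (conj (g w) * (deriv g w * e)).re) / (1 - ‖g w‖ ^ 2) := by
  have hd := (contDiffAt_log_one_sub_norm_sq hg h1).differentiableAt (by norm_num)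
  rw [← hd.lineDeriv_eq_fderiv]
  have h := hasDerivAt_log_one_sub_norm_sq (s := 0)
    (hasDerivAt_comp_line hg.differentiableAt.hasDerivAt e) (by simpa using h1)
  rw [lineDeriv, h.deriv]
  simp only [zero_smul, add_zero]

/-- The second derivatives along `1` and `I` are added. The terms containing `g''` carry the factor
`e²` and cancel; what remains simplifies to `-4 |g'|²` over the squared denominator. -/
theorem laplacian_log_one_sub_norm_sq {g : ℂ → ℂ} {z : ℂ} (hg : AnalyticAt ℂ g z)
    (h1 : ‖g z‖ < 1) :
    Laplacian.laplacian (fun w => Real.log (1 - ‖g w‖ ^ 2)) z =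
      -4 * ‖deriv g z‖ ^ 2 / (1 - ‖g z‖ ^ 2) ^ 2 := by
  set u : ℂ → ℝ := fun w => Real.log (1 - ‖g w‖ ^ 2) with hu
  have hC : ContDiffAt ℝ 2 u z := contDiffAt_log_one_sub_norm_sq hg h1
  have hd2 : DifferentiableAt ℝ (fderiv ℝ u) z :=
    (hC.fderiv_right (m := 1) (by norm_num)).differentiableAt (by norm_num)
  have hev : ∀ᶠ w in 𝓝 z, AnalyticAt ℂ g w ∧ ‖g w‖ < 1 :=
    hg.eventually_analyticAt.and (hg.continuousAt.norm.eventually_lt continuousAt_const h1)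
  have hpos := one_sub_norm_sq_pos h1
  set d := deriv g z with hd
  set d2 := deriv (deriv g) z with hd2'
  have second : ∀ e : ℂ, iteratedFDeriv ℝ 2 u z ![e, e] =
      (-(2 * (conj (d * e) * (d * e) + conj (g z) * (d2 * e * e)).re) * (1 - ‖g z‖ ^ 2)
        - (2 * (conj (g z) * (d * e)).re) ^ 2) / (1 - ‖g z‖ ^ 2) ^ 2 := by
    intro e
    rw [iteratedFDeriv_two_apply]
    simp only [Matrix.cons_val_zero, Matrix.cons_val_one]
    have h1' : fderiv ℝ (fderiv ℝ u) z e e = fderiv ℝ (fun w => fderiv ℝ u w e) z e := by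
      rw [fderiv_clm_apply hd2 (differentiableAt_const e)]
      simp
    have hd3 : DifferentiableAt ℝ (fun w => fderiv ℝ u w e) z :=
      hd2.clm_apply (differentiableAt_const e)
    rw [h1', ← hd3.lineDeriv_eq_fderiv, lineDeriv]
    have hline : Filter.Tendsto (fun s : ℝ => z + s • e) (𝓝 0) (𝓝 z) := by
      have : Continuous fun s : ℝ => z + s • e := by fun_prop
      simpa using this.tendsto 0
    have heq : (fun s : ℝ => fderiv ℝ u (z + s • e) e) =ᶠ[𝓝 0] fun s : ℝ =>
        -(2 * (conj (g (z + s • e)) * (deriv g (z + s • e) * e)).re) /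
          (1 - ‖g (z + s • e)‖ ^ 2) := by
      filter_upwards [hline.eventually hev] with s hs
      exact fderiv_log_one_sub_norm_sq hs.1 hs.2 e
    rw [heq.deriv_eq]
    have hgl := hasDerivAt_comp_line hg.differentiableAt.hasDerivAt e
    have hdl := (hasDerivAt_comp_line hg.deriv.differentiableAt.hasDerivAt e).mul_const e
    have hconj : HasDerivAt (fun s : ℝ => conj (g (z + s • e))) (conj (d * e)) 0 :=
      Complex.conjCLE.hasFDerivAt.comp_hasDerivAt (0 : ℝ) hgl
    have hre : HasDerivAt (fun s : ℝ => (conj (g (z + s • e)) * (deriv g (z + s • e) * e)).re)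
        (conj (d * e) * (d * e) + conj (g z) * (d2 * e * e)).re 0 := by
      have := Complex.reCLM.hasFDerivAt.comp_hasDerivAt (0 : ℝ) (hconj.mul hdl)
      simp only [zero_smul, add_zero] at this
      exact this
    have hden := hgl.norm_sq.const_sub 1
    have hq := (hre.const_mul 2).neg.div hden (by simpa using hpos.ne')
    rw [HasDerivAt.deriv (by simpa only [Pi.neg_apply] using! hq)]
    simp only [Complex.inner, zero_smul, add_zero]
    rw [mul_comm (d * e) (conj (g z))]
    ring
  rw [InnerProductSpace.laplacian_eq_iteratedFDeriv_complexPlane]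
  simp only [second]
  rw [← add_div]
  congr 1
  simp only [← Complex.normSq_eq_norm_sq, Complex.normSq_apply]
  simp only [Complex.add_re, Complex.mul_re, Complex.mul_im, Complex.conj_re, Complex.conj_im,
    Complex.one_re, Complex.one_im, Complex.I_re, Complex.I_im]
  ring

theorem contDiffAt_sum_log_one_sub_norm_sq {ι : Type*} (s : Finset ι) {g : ι → ℂ → ℂ} {z : ℂ}
    (hg : ∀ j ∈ s, AnalyticAt ℂ (g j) z) (h1 : ∀ j ∈ s, ‖g j z‖ < 1) :
    ContDiffAt ℝ 2 (fun w => ∑ j ∈ s, Real.log (1 - ‖g j w‖ ^ 2)) z :=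
  ContDiffAt.sum fun j hj => contDiffAt_log_one_sub_norm_sq (hg j hj) (h1 j hj)

theorem laplacian_sum_log_one_sub_norm_sq {ι : Type*} (s : Finset ι) {g : ι → ℂ → ℂ} {z : ℂ}
    (hg : ∀ j ∈ s, AnalyticAt ℂ (g j) z) (h1 : ∀ j ∈ s, ‖g j z‖ < 1) :
    Laplacian.laplacian (fun w => ∑ j ∈ s, Real.log (1 - ‖g j w‖ ^ 2)) z =
      -4 * ∑ j ∈ s, ‖deriv (g j) z‖ ^ 2 / (1 - ‖g j z‖ ^ 2) ^ 2 := by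
  classical
  induction s using Finset.induction_on with
  | empty => simp
  | insert i s hi ih =>
    have e : (fun w => ∑ j ∈ insert i s, Real.log (1 - ‖g j w‖ ^ 2)) =
        (fun w => Real.log (1 - ‖g i w‖ ^ 2)) + fun w => ∑ j ∈ s, Real.log (1 - ‖g j w‖ ^ 2) := by
      ext w; simp [Finset.sum_insert hi]
    rw [e, ContDiffAt.laplacian_add, laplacian_log_one_sub_norm_sq (hg i (by simp)) (h1 i (by simp)),
      ih (fun j hj => hg j (by simp [hj])) fun j hj => h1 j (by simp [hj]), Finset.sum_insert hi]
    · ring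
    · exact contDiffAt_log_one_sub_norm_sq (hg i (by simp)) (h1 i (by simp))
    · exact contDiffAt_sum_log_one_sub_norm_sq s (fun j hj => hg j (by simp [hj]))
        fun j hj => h1 j (by simp [hj])

theorem bergmanMetric_polydisk {p : ℕ} {z : Fin p → ℂ} (hz : z ∈ polydisk p) (v : Fin p → ℂ) :
    bergmanMetric (polydisk p) z v = 2 * ∑ j, ‖v j‖ ^ 2 / (1 - ‖z j‖ ^ 2) ^ 2 := by
  have hcont : Continuous fun t : ℂ => z + t • v := by fun_prop
  have hev : ∀ᶠ t in 𝓝 (0 : ℂ), z + t • v ∈ polydisk p :=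
    hcont.continuousAt.eventually_mem (by simpa using (isOpen_polydisk p).mem_nhds hz)
  have heq : (fun t : ℂ => Real.log (bergmanKernel (polydisk p) (z + t • v))) =ᶠ[𝓝 0]
      (fun _ : ℂ => Real.log (bergmanKernel (polydisk p) 0)) +
      ((-2 : ℝ) • fun t : ℂ => ∑ j, Real.log (1 - ‖z j + t * v j‖ ^ 2)) := by
    filter_upwards [hev] with t ht
    have hne : ∀ j, (1 - ‖(z + t • v) j‖ ^ 2)⁻¹ ≠ 0 := fun j =>
      inv_ne_zero (one_sub_norm_sq_pos (ht j)).ne'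
    rw [bergmanKernel_polydisk ht, Real.log_mul
      (pow_ne_zero 2 (Finset.prod_ne_zero_iff.2 fun j _ => hne j))
      (bergmanKernel_polydisk_zero_pos p).ne', Real.log_pow,
      Real.log_prod fun j _ => hne j]
    simp [Real.log_inv]
    ring
  have han : ∀ j ∈ Finset.univ, AnalyticAt ℂ (fun t : ℂ => z j + t * v j) 0 := fun j _ => by
    fun_prop
  have h1 : ∀ j ∈ Finset.univ, ‖z j + 0 * v j‖ < 1 := fun j _ => by simpa using hz j
  have hC := contDiffAt_sum_log_one_sub_norm_sq Finset.univ han h1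
  rw [bergmanMetric, (InnerProductSpace.laplacian_congr_nhds heq).eq_of_nhds,
    ContDiffAt.laplacian_add contDiffAt_const (f₂ := (-2 : ℝ) • _) (hC.const_smul (-2 : ℝ)),
    InnerProductSpace.laplacian_smul _ hC, laplacian_sum_log_one_sub_norm_sq Finset.univ han h1,
    InnerProductSpace.laplacian_const]
  have hder : ∀ j, deriv (fun t : ℂ => z j + t * v j) 0 = v j := fun j => by simp
  simp only [hder, zero_mul, add_zero, Pi.zero_apply, zero_add, smul_eq_mul]
  ring

theorem bergmanMetric_unitDisk {z : ℂ} (hz : z ∈ unitDisk) (v : ℂ) :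
    bergmanMetric unitDisk z v = 2 * (‖v‖ ^ 2 / (1 - ‖z‖ ^ 2) ^ 2) := by
  have hcont : Continuous fun t : ℂ => z + t • v := by fun_prop
  have hev : ∀ᶠ t in 𝓝 (0 : ℂ), z + t • v ∈ unitDisk :=
    hcont.continuousAt.eventually_mem (by simpa using isOpen_unitDisk.mem_nhds hz)
  have heq : (fun t : ℂ => Real.log (bergmanKernel unitDisk (z + t • v))) =ᶠ[𝓝 0]
      (fun _ : ℂ => Real.log (bergmanKernel unitDisk 0)) +
      ((-2 : ℝ) • fun t : ℂ => Real.log (1 - ‖z + t * v‖ ^ 2)) := by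
    filter_upwards [hev] with t ht
    have hne : (1 - ‖z + t • v‖ ^ 2)⁻¹ ≠ 0 := inv_ne_zero (one_sub_norm_sq_pos ht).ne'
    rw [bergmanKernel_unitDisk ht, Real.log_mul (pow_ne_zero 2 hne)
      bergmanKernel_unitDisk_zero_pos.ne', Real.log_pow]
    simp [Real.log_inv]
    ring
  have han : AnalyticAt ℂ (fun t : ℂ => z + t * v) 0 := by fun_prop
  have h1 : ‖z + 0 * v‖ < 1 := by simpa using (show ‖z‖ < 1 from hz)
  have hC := contDiffAt_log_one_sub_norm_sq han h1
  rw [bergmanMetric, (InnerProductSpace.laplacian_congr_nhds heq).eq_of_nhds,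
    ContDiffAt.laplacian_add contDiffAt_const (f₂ := (-2 : ℝ) • _) (hC.const_smul (-2 : ℝ)),
    InnerProductSpace.laplacian_smul _ hC, laplacian_log_one_sub_norm_sq han h1,
    InnerProductSpace.laplacian_const]
  have hder : deriv (fun t : ℂ => z + t * v) 0 = v := by simp
  simp only [hder, zero_mul, add_zero, Pi.zero_apply, zero_add, smul_eq_mul]
  ring

end Metric

/-! ### Polarization and the functional equation -/

section Polarization

open scoped ComplexConjugate Topology

/-- If `∑ a_k(z) conj b_k(z)` vanishes on an open set, so does `∑ a_k'(z) conj b_k(z)`. -/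
theorem sum_deriv_mul_conj_eq_zero {ι : Type*} [Fintype ι] {U : Set ℂ} (hU : IsOpen U)
    {a b : ι → ℂ → ℂ} (ha : ∀ k, DifferentiableOn ℂ (a k) U)
    (hb : ∀ k, DifferentiableOn ℂ (b k) U)
    (h : ∀ z ∈ U, ∑ k, a k z * conj (b k z) = 0) {z : ℂ} (hz : z ∈ U) :
    ∑ k, deriv (a k) z * conj (b k z) = 0 := by
  have hda := fun k => ((ha k).differentiableAt (hU.mem_nhds hz)).hasDerivAt
  have hdb := fun k => ((hb k).differentiableAt (hU.mem_nhds hz)).hasDerivAt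
  have dir : ∀ e : ℂ, ∑ k, (deriv (a k) z * e * conj (b k z) +
      a k z * conj (deriv (b k) z * e)) = 0 := by
    intro e
    have hconj : ∀ k, HasDerivAt (fun s : ℝ => conj (b k (z + s • e)))
        (conj (deriv (b k) z * e)) 0 := fun k =>
      Complex.conjCLE.hasFDerivAt.comp_hasDerivAt (0 : ℝ) (hasDerivAt_comp_line (hdb k) e)
    have h1 := HasDerivAt.fun_sum (u := Finset.univ) fun k _ =>
      (hasDerivAt_comp_line (hda k) e).mul (hconj k)
    have hline : Filter.Tendsto (fun s : ℝ => z + s • e) (𝓝 0) (𝓝 z) := by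
      have : Continuous fun s : ℝ => z + s • e := by fun_prop
      simpa using this.tendsto 0
    have h2 : HasDerivAt (fun s : ℝ => ∑ k, a k (z + s • e) * conj (b k (z + s • e))) 0 0 := by
      refine (hasDerivAt_const (0 : ℝ) (0 : ℂ)).congr_of_eventuallyEq ?_
      filter_upwards [hline.eventually (hU.mem_nhds hz)] with s hs using h _ hs
    have h3 := h1.unique h2
    simpa only [zero_smul, add_zero] using h3
  -- The directions `1` and `I` separate the part that is complex linear in `e` from the conjugate
  -- linear part.
  have h1 := dir 1
  have hI := dir Complex.I
  simp only [Finset.sum_add_distrib, mul_one, map_mul, Complex.conj_I] at h1 hI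
  have e1 : ∑ k, deriv (a k) z * Complex.I * conj (b k z) =
      Complex.I * ∑ k, deriv (a k) z * conj (b k z) := by
    rw [Finset.mul_sum]; exact Finset.sum_congr rfl fun k _ => by ring
  have e2 : ∑ k, a k z * (conj (deriv (b k) z) * -Complex.I) =
      -Complex.I * ∑ k, a k z * conj (deriv (b k) z) := by
    rw [Finset.mul_sum]; exact Finset.sum_congr rfl fun k _ => by ring
  rw [e1, e2] at hI
  have h2 : (2 * Complex.I) * ∑ k, deriv (a k) z * conj (b k z) = 0 := by
    linear_combination hI + Complex.I * h1
  simpa using h2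

theorem differentiableOn_iteratedDeriv {U : Set ℂ} (hU : IsOpen U) {g : ℂ → ℂ}
    (hg : DifferentiableOn ℂ g U) (n : ℕ) : DifferentiableOn ℂ (iteratedDeriv n g) U := by
  induction n with
  | zero => simpa using hg
  | succ n ih => rw [iteratedDeriv_succ]; exact ih.deriv hU

/-- Polarization: a sesquiholomorphic function vanishing on the diagonal vanishes. -/
theorem sum_mul_conj_eq_zero {ι : Type*} [Fintype ι] {U : Set ℂ} (hU : IsOpen U)
    (hUc : IsPreconnected U)
    {a b : ι → ℂ → ℂ} (ha : ∀ k, DifferentiableOn ℂ (a k) U)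
    (hb : ∀ k, DifferentiableOn ℂ (b k) U)
    (h : ∀ z ∈ U, ∑ k, a k z * conj (b k z) = 0) {z w : ℂ} (hz : z ∈ U) (hw : w ∈ U) :
    ∑ k, a k z * conj (b k w) = 0 := by
  -- Differentiating only the holomorphic factors preserves vanishing on the diagonal. Hence all
  -- Taylor coefficients at `w` of the function with `w` frozen in the conjugate factor are zero.
  have hn : ∀ n : ℕ, ∀ z ∈ U, ∑ k, iteratedDeriv n (a k) z * conj (b k z) = 0 := by
    intro n
    induction n with
    | zero => simpa using h
    | succ n ih =>
      intro z hz
      simp only [iteratedDeriv_succ]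
      exact sum_deriv_mul_conj_eq_zero hU
        (fun k => differentiableOn_iteratedDeriv hU (ha k) n) hb ih hz
  have hF : DifferentiableOn ℂ (fun z => ∑ k, a k z * conj (b k w)) U :=
    DifferentiableOn.fun_sum fun k _ => (ha k).mul_const _
  have hder : ∀ n : ℕ, ∀ z ∈ U, iteratedDeriv n (fun z => ∑ k, a k z * conj (b k w)) z =
      ∑ k, iteratedDeriv n (a k) z * conj (b k w) := by
    intro n
    induction n with
    | zero => simp
    | succ n ih =>
      intro z hz
      rw [iteratedDeriv_succ, (Filter.eventuallyEq_of_mem (hU.mem_nhds hz) ih).deriv_eq]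
      simp only [iteratedDeriv_succ]
      rw [deriv_fun_sum]
      · exact Finset.sum_congr rfl fun k _ => deriv_mul_const_field _
      · intro k _
        exact ((differentiableOn_iteratedDeriv hU (ha k) n).differentiableAt
          (hU.mem_nhds hz)).mul_const _
  have han := hF.analyticOnNhd hU
  have hev : (fun z => ∑ k, a k z * conj (b k w)) =ᶠ[𝓝 w] 0 := by
    have hps := (han w hw).hasFPowerSeriesAt
    have h0 : (fun n => iteratedDeriv n (fun z => ∑ k, a k z * conj (b k w)) w /
        (n.factorial : ℂ)) = 0 := by
      funext n
      rw [hder n w hw, hn n w hw, zero_div]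
      rfl
    rw [h0, FormalMultilinearSeries.ofScalars_series_eq_zero_of_scalar_zero] at hps
    exact HasFPowerSeriesAt.eventually_eq_zero hps
  exact han.eqOn_zero_of_preconnected_of_eventuallyEq_zero hUc hw hev hz

end Polarization

/-! ### The Hermitian form on the target of the Segre embedding -/

section Segre

open scoped ComplexConjugate

variable {p : ℕ}

/-- The Hermitian form `∑ ± x_ε conj y_ε` on `ℂ^{2^p}`, the tensor power of the form of signature
`(1, 1)` on `ℂ²`. -/
noncomputable def segreForm (p : ℕ) :
    ((Fin p → Fin 2) → ℂ) →ₗ[ℂ] ((Fin p → Fin 2) → ℂ) →ₛₗ[starRingEnd ℂ] ℂ :=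
  LinearMap.mk₂'ₛₗ (RingHom.id ℂ) (starRingEnd ℂ)
    (fun x y => ∑ ε, (∏ j, (-1) ^ (ε j : ℕ)) * (x ε * conj (y ε)))
    (fun x y z => by
      rw [← Finset.sum_add_distrib]
      exact Finset.sum_congr rfl fun ε _ => by simp only [Pi.add_apply]; ring)
    (fun c x y => by
      rw [RingHom.id_apply, Finset.smul_sum]
      exact Finset.sum_congr rfl fun ε _ => by simp only [Pi.smul_apply, smul_eq_mul]; ring)
    (fun x y z => by
      rw [← Finset.sum_add_distrib]
      exact Finset.sum_congr rfl fun ε _ => by simp only [Pi.add_apply, map_add]; ring)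
    (fun c x y => by
      rw [Finset.smul_sum]
      exact Finset.sum_congr rfl fun ε _ => by
        simp only [Pi.smul_apply, smul_eq_mul, map_mul]; ring)

theorem segreForm_apply (x y : (Fin p → Fin 2) → ℂ) :
    segreForm p x y = ∑ ε, (∏ j, (-1) ^ (ε j : ℕ)) * (x ε * conj (y ε)) := rfl

/-- Expanding the product of two-term sums gives one term for each `ε`, with its sign. -/
theorem segreForm_segreVec (v w : Fin p → Fin 2 → ℂ) :
    segreForm p (segreVec v) (segreVec w) =
      ∏ j, (v j 0 * conj (w j 0) - v j 1 * conj (w j 1)) := by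
  have h : ∀ j, v j 0 * conj (w j 0) - v j 1 * conj (w j 1) =
      ∑ e ∈ (Finset.univ : Finset (Fin 2)), (-1) ^ (e : ℕ) * (v j e * conj (w j e)) := by
    intro j
    rw [Fin.sum_univ_two]
    simp only [Fin.val_zero, Fin.val_one]
    ring
  simp only [h]
  rw [Finset.prod_univ_sum, segreForm_apply, Fintype.piFinset_univ]
  refine Finset.sum_congr rfl fun ε _ => ?_
  simp only [segreVec, map_prod, Finset.prod_mul_distrib]

/-- The affine lift `z ↦ ⊗ (1, z_j)` of `segreAffine`. -/
def affineSegreVec (z : Fin p → ℂ) : (Fin p → Fin 2) → ℂ := segreVec fun j => ![1, z j]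

theorem affineSegreVec_ne_zero (z : Fin p → ℂ) : affineSegreVec z ≠ 0 :=
  segreVec_ne_zero _ fun j => one_coord_ne_zero (z j)

theorem segreAffine_eq_mk (z : Fin p → ℂ) :
    segreAffine z = Projectivization.mk ℂ (affineSegreVec z) (affineSegreVec_ne_zero z) :=
  segre_mk _ _

theorem segreForm_affineSegreVec (z w : Fin p → ℂ) :
    segreForm p (affineSegreVec z) (affineSegreVec w) = ∏ j, (1 - z j * conj (w j)) := by
  rw [affineSegreVec, affineSegreVec, segreForm_segreVec]
  simp

theorem segreVec_update_apply (v : Fin p → Fin 2 → ℂ) (j : Fin p) (w : Fin 2 → ℂ)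
    (ε : Fin p → Fin 2) :
    segreVec (Function.update v j w) ε = w (ε j) * ∏ i ∈ Finset.univ.erase j, v i (ε i) := by
  rw [segreVec, ← Finset.mul_prod_erase _ _ (Finset.mem_univ j), Function.update_self]
  congr 1
  exact Finset.prod_congr rfl fun i hi => by
    rw [Function.update_of_ne (Finset.ne_of_mem_erase hi)]

theorem segreVec_update_add_smul (v : Fin p → Fin 2 → ℂ) (j : Fin p) (a b : ℂ)
    (w w' : Fin 2 → ℂ) :
    segreVec (Function.update v j (a • w + b • w')) =
      a • segreVec (Function.update v j w) + b • segreVec (Function.update v j w') := by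
  funext ε
  simp only [segreVec_update_apply, Pi.add_apply, Pi.smul_apply, smul_eq_mul]
  ring

/-- The derivative of `affineSegreVec`. -/
def affineSegreDeriv (z : Fin p → ℂ) : (Fin p → ℂ) →ₗ[ℂ] ((Fin p → Fin 2) → ℂ) :=
  ∑ j, (LinearMap.proj (R := ℂ) (φ := fun _ : Fin p => ℂ) j).smulRight
    (segreVec (Function.update (fun i => ![1, z i]) j ![0, 1]))

theorem affineSegreDeriv_apply (z u : Fin p → ℂ) :
    affineSegreDeriv z u =
      ∑ j, u j • segreVec (Function.update (fun i => ![1, z i]) j ![0, 1]) := by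
  simp [affineSegreDeriv]

theorem hasStrictFDerivAt_affineSegreVec (z : Fin p → ℂ) :
    HasStrictFDerivAt affineSegreVec (affineSegreDeriv z).toContinuousLinearMap z := by
  rw [hasStrictFDerivAt_pi']
  intro ε
  have h : ∀ j ∈ (Finset.univ : Finset (Fin p)), HasStrictFDerivAt
      (fun w : Fin p → ℂ => (![1, w j] : Fin 2 → ℂ) (ε j))
      ((![0, 1] : Fin 2 → ℂ) (ε j) • ContinuousLinearMap.proj (R := ℂ) (φ := fun _ => ℂ) j) z := by
    intro j _
    have h2 : ∀ e : Fin 2, HasStrictFDerivAt (fun w : Fin p → ℂ => (![1, w j] : Fin 2 → ℂ) e)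
      ((![0, 1] : Fin 2 → ℂ) e • ContinuousLinearMap.proj (R := ℂ) (φ := fun _ => ℂ) j) z := by
      intro e
      fin_cases e
      · exact (hasStrictFDerivAt_const (𝕜 := ℂ) (1 : ℂ) z).congr_fderiv (by ext; simp)
      · simpa using hasStrictFDerivAt_apply (𝕜 := ℂ) j z
    exact h2 (ε j)
  have h3 := HasStrictFDerivAt.finsetProd h
  refine h3.congr_fderiv ?_
  ext u
  simp [affineSegreDeriv_apply, segreVec_update_apply]
  refine Finset.sum_congr rfl fun j _ => ?_
  ring

/-- The component of the tangent vector `affineSegreDeriv z u` that is orthogonal to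
`affineSegreVec z`. -/
noncomputable def affineSegreNormal (z u : Fin p → ℂ) : (Fin p → Fin 2) → ℂ :=
  ∑ j, (u j / (1 - ‖z j‖ ^ 2)) •
    segreVec (Function.update (fun i => ![1, z i]) j ![conj (z j), 1])

/-- In factor `j`, `(0, 1)` is replaced by a multiple of `(conj z_j, 1)`, which is orthogonal to
`(1, z_j)` for the form of signature `(1, 1)`. The correction is a multiple of the lift, so a
subspace containing the lift and the tangent vector also contains the normal vector. -/
theorem affineSegreNormal_eq {z : Fin p → ℂ} (hz : z ∈ polydisk p) (u : Fin p → ℂ) :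
    affineSegreNormal z u = affineSegreDeriv z u +
      (∑ j, u j / (1 - ‖z j‖ ^ 2) * conj (z j)) • affineSegreVec z := by
  rw [affineSegreDeriv_apply, Finset.sum_smul, ← Finset.sum_add_distrib]
  refine Finset.sum_congr rfl fun j _ => ?_
  have hne : ((1 : ℂ) - ‖z j‖ ^ 2) ≠ 0 := by
    exact_mod_cast (one_sub_norm_sq_pos (hz j)).ne'
  have hv : (![conj (z j), 1] : Fin 2 → ℂ) =
      conj (z j) • ![1, z j] + ((1 : ℂ) - ‖z j‖ ^ 2) • ![0, 1] := by
    funext e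
    fin_cases e
    · simp
    · have := conj_mul_self_eq (z j)
      push_cast at this
      simp [this]
  rw [hv, segreVec_update_add_smul, Function.update_eq_self j (fun i => ![1, z i])]
  rw [smul_add, smul_smul, smul_smul, div_mul_cancel₀ _ hne, add_comm]
  rfl

theorem affineSegreNormal_add_smul (z u v : Fin p → ℂ) (a b : ℂ) :
    affineSegreNormal z (a • u + b • v) =
      a • affineSegreNormal z u + b • affineSegreNormal z v := by
  simp only [affineSegreNormal, Finset.smul_sum, ← Finset.sum_add_distrib, smul_smul, ← add_smul]
  refine Finset.sum_congr rfl fun j _ => ?_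
  congr 1
  simp only [Pi.add_apply, Pi.smul_apply, smul_eq_mul]
  ring

/-- Summands with different indices are orthogonal, because factor `j` pairs `(conj z_j, 1)` with
`(1, z_j)`. A diagonal term has `|z_j|² - 1` in factor `j` and `1 - |z_i|²` in the others. -/
theorem segreForm_affineSegreNormal (z u : Fin p → ℂ) :
    segreForm p (affineSegreNormal z u) (affineSegreNormal z u) =
      ((∑ j, ‖u j / (1 - ‖z j‖ ^ 2)‖ ^ 2 *
        ((‖z j‖ ^ 2 - 1) * ∏ i ∈ Finset.univ.erase j, (1 - ‖z i‖ ^ 2)) : ℝ) : ℂ) := by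
  have hmul := fun j => conj_mul_self_eq (z j)
  have off : ∀ j i, j ≠ i → segreForm p
      (segreVec (Function.update (fun i => ![1, z i]) j ![conj (z j), 1]))
      (segreVec (Function.update (fun i => ![1, z i]) i ![conj (z i), 1])) = 0 := by
    intro j i hji
    rw [segreForm_segreVec]
    refine Finset.prod_eq_zero (Finset.mem_univ j) ?_
    rw [Function.update_self, Function.update_of_ne hji]
    simp
  have diag : ∀ j, segreForm p
      (segreVec (Function.update (fun i => ![1, z i]) j ![conj (z j), 1]))
      (segreVec (Function.update (fun i => ![1, z i]) j ![conj (z j), 1])) =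
      (((‖z j‖ ^ 2 - 1) * ∏ i ∈ Finset.univ.erase j, (1 - ‖z i‖ ^ 2) : ℝ) : ℂ) := by
    intro j
    rw [segreForm_segreVec, ← Finset.mul_prod_erase _ _ (Finset.mem_univ j), Complex.ofReal_mul,
      Complex.ofReal_prod]
    congr 1
    · rw [Function.update_self]
      simp only [Matrix.cons_val_zero, Matrix.cons_val_one, Complex.conj_conj, map_one, mul_one]
      rw [hmul]; push_cast; ring
    · refine Finset.prod_congr rfl fun i hi => ?_
      rw [Function.update_of_ne (Finset.ne_of_mem_erase hi)]
      simp only [Matrix.cons_val_zero, Matrix.cons_val_one, map_one, mul_one]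
      rw [mul_comm, hmul]; push_cast; ring
  simp only [affineSegreNormal, map_sum, LinearMap.sum_apply]
  push_cast
  refine Finset.sum_congr rfl fun j _ => ?_
  rw [Finset.sum_eq_single j]
  · simp only [map_smul, LinearMap.map_smulₛₗ, LinearMap.smul_apply, smul_eq_mul]
    rw [diag, ← mul_assoc, ← Complex.normSq_eq_conj_mul_self, Complex.normSq_eq_norm_sq]
    push_cast
    rfl
  · intro i _ hij
    simp only [map_smul, LinearMap.map_smulₛₗ, LinearMap.smul_apply, smul_eq_mul]
    rw [off i j hij, mul_zero, mul_zero]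
  · simp

theorem segreForm_affineSegreNormal_neg {z u : Fin p → ℂ} (hz : z ∈ polydisk p) (hu : u ≠ 0) :
    (segreForm p (affineSegreNormal z u) (affineSegreNormal z u)).re < 0 := by
  rw [segreForm_affineSegreNormal, Complex.ofReal_re]
  have hpos := fun j => one_sub_norm_sq_pos (hz j)
  have hprod : ∀ j, 0 < ∏ i ∈ Finset.univ.erase j, (1 - ‖z i‖ ^ 2) := fun j =>
    Finset.prod_pos fun i _ => hpos i
  obtain ⟨j, hj⟩ := Function.ne_iff.1 hu
  refine Finset.sum_neg' (fun i _ => ?_) ⟨j, Finset.mem_univ j, ?_⟩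
  · exact mul_nonpos_of_nonneg_of_nonpos (by positivity)
      (mul_nonpos_of_nonpos_of_nonneg (by linarith [hpos i]) (hprod i).le)
  · refine mul_neg_of_pos_of_neg (pow_pos (norm_pos_iff.2 (div_ne_zero hj ?_)) 2)
      (mul_neg_of_neg_of_pos (by linarith [hpos j]) (hprod j))
    exact_mod_cast (hpos j).ne'

end Segre

/-! ### The functional equation of a holomorphic isometry -/

section FunctionalEquation

open scoped ComplexConjugate Topology

variable {p : ℕ} {f : ℂ → Fin p → ℂ}

theorem isPreconnected_unitDisk : IsPreconnected unitDisk := by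
  rw [unitDisk_eq_ball]
  exact (convex_ball 0 1).isPreconnected

theorem analyticAt_coord (hf : DifferentiableOn ℂ f unitDisk) {z : ℂ} (hz : z ∈ unitDisk)
    (j : Fin p) : AnalyticAt ℂ (fun w => f w j) z :=
  (differentiableOn_pi.1 hf j).analyticAt (isOpen_unitDisk.mem_nhds hz)

/-- The isometry equation in coordinates. -/
theorem IsHolomorphicIsometry.sum_norm_deriv_sq
    (hf : IsHolomorphicIsometry 2 unitDisk (polydisk p) f) {z : ℂ} (hz : z ∈ unitDisk) :
    ∑ j, ‖deriv (fun w => f w j) z‖ ^ 2 / (1 - ‖f z j‖ ^ 2) ^ 2 =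
      2 * (1 / (1 - ‖z‖ ^ 2) ^ 2) := by
  obtain ⟨hmaps, hd, hiso⟩ := hf
  have h := hiso z hz 1
  rw [bergmanMetric_polydisk (hmaps hz), bergmanMetric_unitDisk hz] at h
  have hder : ∀ j, fderiv ℂ f z 1 j = deriv (fun w => f w j) z := by
    intro j
    have h1 := (hd.differentiableAt (isOpen_unitDisk.mem_nhds hz)).hasFDerivAt
    exact ((hasFDerivAt_pi'.1 h1 j).hasDerivAt).deriv.symm
  simp only [hder, norm_one, one_pow] at h
  linarith

/-- The isometry equation makes the difference of the two potentials harmonic, hence equal to `Re F`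
on the disk. Since `|exp (F/2)|² = exp (Re F)`, the choice `H = exp (F/2)` works. -/
theorem IsHolomorphicIsometry.exists_prod_eq
    (hf : IsHolomorphicIsometry 2 unitDisk (polydisk p) f) :
    ∃ H : ℂ → ℂ, DifferentiableOn ℂ H unitDisk ∧ (∀ z, H z ≠ 0) ∧ ∀ z ∈ unitDisk,
      ∏ j, (1 - ‖f z j‖ ^ 2) = ‖H z‖ ^ 2 * (1 - ‖z‖ ^ 2) ^ 2 := by
  obtain ⟨hmaps, hd, -⟩ := id hf
  set u₁ : ℂ → ℝ := fun w => ∑ j, Real.log (1 - ‖f w j‖ ^ 2) with hu₁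
  set u₂ : ℂ → ℝ := fun w => Real.log (1 - ‖id w‖ ^ 2) with hu₂
  have hC₁ : ∀ z ∈ unitDisk, ContDiffAt ℝ 2 u₁ z := fun z hz =>
    contDiffAt_sum_log_one_sub_norm_sq Finset.univ (g := fun j w => f w j)
      (fun j _ => analyticAt_coord hd hz j) fun j _ => hmaps hz j
  have hC₂ : ∀ z ∈ unitDisk, ContDiffAt ℝ 2 u₂ z := fun z hz =>
    contDiffAt_log_one_sub_norm_sq analyticAt_id hz
  have hC₂' : ∀ z ∈ unitDisk, ContDiffAt ℝ 2 ((2 : ℝ) • u₂) z := fun z hz =>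
    (hC₂ z hz).const_smul (2 : ℝ)
  have hL : ∀ z ∈ unitDisk, Laplacian.laplacian (u₁ - (2 : ℝ) • u₂) z = 0 := by
    intro z hz
    rw [(hC₁ z hz).laplacian_sub (hC₂' z hz), InnerProductSpace.laplacian_smul _ (hC₂ z hz),
      laplacian_log_one_sub_norm_sq analyticAt_id hz,
      laplacian_sum_log_one_sub_norm_sq Finset.univ (g := fun j w => f w j)
      (fun j _ => analyticAt_coord hd hz j) fun j _ => hmaps hz j,
      hf.sum_norm_deriv_sq hz, deriv_id]
    simp
    ring
  have hharm : InnerProductSpace.HarmonicOnNhd (u₁ - (2 : ℝ) • u₂) (Metric.ball 0 1) := by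
    rw [← unitDisk_eq_ball]
    exact fun z hz => ⟨(hC₁ z hz).sub (hC₂' z hz),
      Filter.eventuallyEq_of_mem (isOpen_unitDisk.mem_nhds hz) hL⟩
  obtain ⟨F, hF, hre⟩ := hharm.exists_analyticOnNhd_ball_re_eq
  rw [← unitDisk_eq_ball] at hF hre
  refine ⟨fun z => Complex.exp (F z / 2), ?_, fun z => Complex.exp_ne_zero _, fun z hz => ?_⟩
  · exact (hF.differentiableOn.div_const 2).cexp
  · have h1 : (F z).re = u₁ z - 2 * u₂ z := hre hz
    have hpos := fun j => one_sub_norm_sq_pos (hmaps hz j)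
    have hzpos : 0 < 1 - ‖z‖ ^ 2 := one_sub_norm_sq_pos hz
    have h2 : ‖Complex.exp (F z / 2)‖ ^ 2 = Real.exp (F z).re := by
      rw [Complex.norm_exp, ← Real.exp_nat_mul]
      congr 1
      simp
      ring
    have h3 : Real.exp (u₁ z) = ∏ j, (1 - ‖f z j‖ ^ 2) := by
      rw [hu₁, Real.exp_sum]
      exact Finset.prod_congr rfl fun j _ => Real.exp_log (hpos j)
    have h4 : Real.exp (2 * u₂ z) = (1 - ‖z‖ ^ 2) ^ 2 := by
      have : Real.exp (u₂ z) = 1 - ‖z‖ ^ 2 := Real.exp_log hzpos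
      rw [← this, ← Real.exp_nat_mul]
      norm_num
    rw [h2, h1, Real.exp_sub, h3, h4, div_mul_cancel₀ _ (pow_ne_zero 2 hzpos.ne')]

theorem differentiableOn_affineSegreVec_comp (hd : DifferentiableOn ℂ f unitDisk)
    (ε : Fin p → Fin 2) : DifferentiableOn ℂ (fun z => affineSegreVec (f z) ε) unitDisk := by
  intro z hz
  have h := (hasStrictFDerivAt_affineSegreVec (f z)).differentiableAt.comp_differentiableWithinAt
    z (hd z hz)
  exact differentiableWithinAt_pi.1 h ε

/-- The functional equation: up to a cocycle, an isometry pulls back the Hermitian form of the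
Segre embedding to a form of signature `(2, 1)`. -/
theorem IsHolomorphicIsometry.exists_segreForm_eq
    (hf : IsHolomorphicIsometry 2 unitDisk (polydisk p) f) :
    ∃ H : ℂ → ℂ, DifferentiableOn ℂ H unitDisk ∧ (∀ z, H z ≠ 0) ∧
      ∀ z ∈ unitDisk, ∀ w ∈ unitDisk,
      segreForm p (affineSegreVec (f z)) (affineSegreVec (f w)) =
        H z * conj (H w) * (1 - z * conj w) ^ 2 := by
  obtain ⟨hmaps, hd, -⟩ := id hf
  obtain ⟨H, hH, hH0, hprod⟩ := hf.exists_prod_eq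
  refine ⟨H, hH, hH0, fun z hz w hw => ?_⟩
  -- Both sides are collected into one sum `∑ a_k conj b_k`; the three extra terms expand `-(1 - z
  -- conj w)²` times `H(z) conj H(w)`.
  let a : (Fin p → Fin 2) ⊕ Fin 3 → ℂ → ℂ := Sum.elim
    (fun ε z => (∏ j, (-1) ^ (ε j : ℕ)) * affineSegreVec (f z) ε)
    ![fun z => -H z, fun z => 2 * (z * H z), fun z => -(z ^ 2 * H z)]
  let b : (Fin p → Fin 2) ⊕ Fin 3 → ℂ → ℂ := Sum.elim
    (fun ε z => affineSegreVec (f z) ε)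
    ![fun z => H z, fun z => z * H z, fun z => z ^ 2 * H z]
  have hsum : ∀ z w, ∑ k, a k z * conj (b k w) =
      segreForm p (affineSegreVec (f z)) (affineSegreVec (f w)) -
        H z * conj (H w) * (1 - z * conj w) ^ 2 := by
    intro z w
    rw [Fintype.sum_sum_type, Fin.sum_univ_three, segreForm_apply, sub_eq_add_neg]
    congr 1
    · exact Finset.sum_congr rfl fun ε _ => by simp only [a, b, Sum.elim_inl]; ring
    · simp [a, b]
      ring
  have key := sum_mul_conj_eq_zero (a := a) (b := b) isOpen_unitDisk isPreconnected_unitDisk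
    ?_ ?_ ?_ hz hw
  · rw [hsum] at key
    exact sub_eq_zero.1 key
  · rintro (ε | k)
    · exact (differentiableOn_affineSegreVec_comp hd ε).const_mul _
    · fin_cases k
      · exact hH.neg
      · exact (differentiableOn_id.mul hH).const_mul _
      · exact ((differentiableOn_id.pow 2).mul hH).neg
  · rintro (ε | k)
    · exact differentiableOn_affineSegreVec_comp hd ε
    · fin_cases k
      · exact hH
      · exact differentiableOn_id.mul hH
      · exact (differentiableOn_id.pow 2).mul hH
  · intro z hz
    rw [hsum, segreForm_affineSegreVec]
    have h1 : ∀ j, 1 - f z j * conj (f z j) = ((1 - ‖f z j‖ ^ 2 : ℝ) : ℂ) := fun j => by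
      rw [mul_comm, conj_mul_self_eq]; push_cast; ring
    simp only [h1]
    rw [← Complex.ofReal_prod, hprod z hz, mul_comm (H z), conj_mul_self_eq, mul_comm z,
      conj_mul_self_eq]
    push_cast
    ring

end FunctionalEquation

/-! ### Tangent spaces of the linear section -/

section Tangent

open scoped ComplexConjugate

variable {p : ℕ} {f : ℂ → Fin p → ℂ}

/-- The linear span of the image of `f` under the Segre embedding. -/
def segreSpan (f : ℂ → Fin p → ℂ) : Submodule ℂ ((Fin p → Fin 2) → ℂ) :=
  Submodule.span ℂ ((fun z => affineSegreVec (f z)) '' unitDisk)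

theorem affineSegreVec_mem_segreSpan {z : ℂ} (hz : z ∈ unitDisk) :
    affineSegreVec (f z) ∈ segreSpan f :=
  Submodule.subset_span ⟨z, hz, rfl⟩

/-- The Segre form has negative index at most one on the span of the image of an isometry. -/
theorem IsHolomorphicIsometry.exists_segreForm_nonneg
    (hf : IsHolomorphicIsometry 2 unitDisk (polydisk p) f) {x y : (Fin p → Fin 2) → ℂ}
    (hx : x ∈ segreSpan f) (hy : y ∈ segreSpan f) :
    ∃ a b : ℂ, (a ≠ 0 ∨ b ≠ 0) ∧ 0 ≤ (segreForm p (a • x + b • y) (a • x + b • y)).re := by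
  obtain ⟨H, -, -, hH⟩ := hf.exists_segreForm_eq
  -- Recording `(H, zH, z²H)` next to the lift lets the functional equation extend to spans by
  -- sesquilinearity, with no need for a linear map from the span to `ℂ³`.
  set G : ℂ → ((Fin p → Fin 2) → ℂ) × (Fin 3 → ℂ) := fun z =>
    (affineSegreVec (f z), ![H z, z * H z, z ^ 2 * H z]) with hG
  set N := Submodule.span ℂ (G '' unitDisk) with hN
  have hfst : segreSpan f = N.map (LinearMap.fst ℂ _ _) := by
    rw [hN, Submodule.map_span, segreSpan, ← image_comp]
    rfl
  rw [hfst] at hx hy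
  obtain ⟨⟨x, s⟩, hxs, rfl⟩ := hx
  obtain ⟨⟨y, t⟩, hyt, rfl⟩ := hy
  have hform : ∀ v ∈ N, ∀ w ∈ N, segreForm p v.1 w.1 =
      v.2 0 * conj (w.2 0) - 2 * (v.2 1 * conj (w.2 1)) + v.2 2 * conj (w.2 2) := by
    intro v hv w hw
    induction hv, hw using Submodule.span_induction₂ with
    | mem_mem v w hv hw =>
      obtain ⟨z, hz, rfl⟩ := hv
      obtain ⟨z', hz', rfl⟩ := hw
      simp [hG, hH z hz z' hz']
      ring
    | zero_left w hw => simp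
    | zero_right v hv => simp
    | add_left u v w _ _ _ h1 h2 =>
      simp only [Prod.fst_add, Prod.snd_add, map_add, LinearMap.add_apply, Pi.add_apply, h1, h2]
      ring
    | add_right u v w _ _ _ h1 h2 =>
      simp only [Prod.fst_add, Prod.snd_add, map_add, Pi.add_apply, h1, h2]
      ring
    | smul_left r v w _ _ h =>
      simp only [Prod.smul_fst, Prod.smul_snd, map_smul, LinearMap.smul_apply, Pi.smul_apply,
        smul_eq_mul, h]
      ring
    | smul_right r v w _ _ h =>
      simp only [Prod.smul_fst, Prod.smul_snd, LinearMap.map_smulₛₗ, Pi.smul_apply,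
        smul_eq_mul, map_mul, h]
      ring
  -- The combination is chosen to annihilate the only coordinate of negative sign.
  obtain ⟨a, b, hab, h0⟩ : ∃ a b : ℂ, (a ≠ 0 ∨ b ≠ 0) ∧ a * s 1 + b * t 1 = 0 := by
    by_cases hs : s 1 = 0
    · exact ⟨1, 0, Or.inl one_ne_zero, by simp [hs]⟩
    · exact ⟨t 1, -s 1, Or.inr (neg_ne_zero.2 hs), by ring⟩
  refine ⟨a, b, hab, ?_⟩
  have hmem : a • ((x, s) : ((Fin p → Fin 2) → ℂ) × (Fin 3 → ℂ)) + b • (y, t) ∈ N :=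
    N.add_mem (N.smul_mem a hxs) (N.smul_mem b hyt)
  have h := hform _ hmem _ hmem
  change segreForm p (a • x + b • y) (a • x + b • y) = _ at h
  change 0 ≤ (segreForm p (a • x + b • y) (a • x + b • y)).re
  rw [h]
  simp only [Prod.snd_add, Prod.smul_snd, Pi.add_apply, Pi.smul_apply, smul_eq_mul, h0,
    Complex.mul_conj]
  simp only [map_zero, Complex.ofReal_zero, mul_zero, sub_zero, ← Complex.ofReal_add,
    Complex.ofReal_re]
  exact add_nonneg (Complex.normSq_nonneg _) (Complex.normSq_nonneg _)

/-- The Zariski tangent spaces of the linear section are at most one-dimensional. -/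
theorem IsHolomorphicIsometry.exists_tangent_dependent
    (hf : IsHolomorphicIsometry 2 unitDisk (polydisk p) f) {y : Fin p → ℂ}
    (hy : y ∈ polydisk p) (hyM : affineSegreVec y ∈ segreSpan f) {u v : Fin p → ℂ}
    (hu : affineSegreDeriv y u ∈ segreSpan f) (hv : affineSegreDeriv y v ∈ segreSpan f) :
    ∃ a b : ℂ, (a ≠ 0 ∨ b ≠ 0) ∧ a • u + b • v = 0 := by
  have hmem : ∀ u, affineSegreDeriv y u ∈ segreSpan f → affineSegreNormal y u ∈ segreSpan f :=
    fun u hu => by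
      rw [affineSegreNormal_eq hy]
      exact add_mem hu (Submodule.smul_mem _ _ hyM)
  obtain ⟨a, b, hab, h⟩ := hf.exists_segreForm_nonneg (hmem u hu) (hmem v hv)
  refine ⟨a, b, hab, ?_⟩
  by_contra hne
  rw [← affineSegreNormal_add_smul] at h
  exact absurd (segreForm_affineSegreNormal_neg hy hne) (not_lt.2 h)

end Tangent

/-! ### The local structure of the linear section along the isometric disk -/

section LocalStructure

open scoped ComplexConjugate Topology

/-- A minimal set of linear equations cutting out `D⁻¹(M)`. -/
theorem exists_linearMap_surjective_comp {K W V : Type*} [Field K] [AddCommGroup W] [Module K W]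
    [AddCommGroup V] [Module K V] [FiniteDimensional K W] (D : W →ₗ[K] V) (M : Submodule K V) :
    ∃ (k : ℕ) (τ : V →ₗ[K] (Fin k → K)), (∀ x ∈ M, τ x = 0) ∧
      Function.Surjective (τ ∘ₗ D) ∧ ∀ w, τ (D w) = 0 → D w ∈ M := by
  set L : W →ₗ[K] V ⧸ M := M.mkQ ∘ₗ D with hL
  -- `r` projects `V ⧸ M` onto the range of `D` modulo `M`, so exactly as many equations remain as
  -- that range has dimensions.
  obtain ⟨r, hr⟩ := LinearMap.exists_leftInverse_of_injective (LinearMap.range L).subtype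
    (LinearMap.range L).ker_subtype
  set e := (Module.finBasis K (LinearMap.range L)).equivFun
  have hτ : ∀ w, (e.toLinearMap ∘ₗ r ∘ₗ M.mkQ) (D w) = e (L.rangeRestrict w) := fun w =>
    congrArg e (LinearMap.congr_fun hr (L.rangeRestrict w))
  refine ⟨_, e.toLinearMap ∘ₗ r ∘ₗ M.mkQ, fun x hx => ?_, ?_, fun w hw => ?_⟩
  · simp [(Submodule.Quotient.mk_eq_zero M).2 hx]
  · intro c
    obtain ⟨w, hw⟩ := L.surjective_rangeRestrict (e.symm c)
    exact ⟨w, (hτ w).trans (by rw [hw, e.apply_symm_apply])⟩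
  · rw [hτ, e.map_eq_zero_iff] at hw
    have h : L w = 0 := congrArg Subtype.val hw
    exact (Submodule.Quotient.mk_eq_zero M).1 h

/-- Near a point where the kernel of a submersion is spanned by the velocity of a curve in its
zero set, the zero set is the image of the curve. -/
theorem exists_open_zeroSet_subset_image {E F : Type*} [NormedAddCommGroup E] [NormedSpace ℂ E]
    [NormedAddCommGroup F] [NormedSpace ℂ F] [CompleteSpace E] [CompleteSpace F]
    {g : E → F} {g' : E →L[ℂ] F} {γ : ℂ → E} {γ' : E} {z : ℂ} {U : Set ℂ} (hU : U ∈ 𝓝 z)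
    (hg : HasStrictFDerivAt g g' (γ z)) (hsurj : Function.Surjective g')
    (hγ : HasStrictDerivAt γ γ' z) (hγ0 : γ' ≠ 0) (hzero : ∀ w ∈ U, g (γ w) = 0)
    (hker : ∀ v, g' v = 0 → ∃ c : ℂ, v = c • γ') :
    ∃ W : Set E, IsOpen W ∧ γ z ∈ W ∧ ∀ y ∈ W, g y = 0 → y ∈ γ '' U := by
  -- `l` serves as a coordinate along the curve, so that `(g, l)` is a local biholomorphism.
  obtain ⟨l, hl⟩ := SeparatingDual.exists_eq_one (R := ℂ) hγ0
  have hgγ : g' γ' = 0 := by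
    have h1 := (hg.hasFDerivAt.comp_hasDerivAt z hγ.hasDerivAt)
    exact h1.unique ((hasDerivAt_const z (0 : F)).congr_of_eventuallyEq
      (Filter.eventuallyEq_of_mem hU hzero))
  have hbij : Function.Bijective (g'.prod l) := by
    constructor
    · rw [injective_iff_map_eq_zero]
      intro v hv
      obtain ⟨hv1, hv2⟩ := Prod.ext_iff.1 hv
      obtain ⟨c, rfl⟩ := hker v hv1
      have : c = 0 := by simpa [hl] using hv2
      rw [this, zero_smul]
    · rintro ⟨a, c⟩
      obtain ⟨v, hv⟩ := hsurj a
      refine ⟨v + (c - l v) • γ', Prod.ext ?_ ?_⟩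
      · simp [hv, hgγ]
      · simp [hl]
  set e : E ≃L[ℂ] F × ℂ := ContinuousLinearEquiv.ofBijective (g'.prod l)
    (LinearMap.ker_eq_bot.2 hbij.1) (LinearMap.range_eq_top.2 hbij.2) with he
  have hΨ : HasStrictFDerivAt (fun y => (g y, l y)) (e : E →L[ℂ] F × ℂ) (γ z) := by
    rw [he, ContinuousLinearEquiv.coe_ofBijective]
    exact hg.prodMk l.hasStrictFDerivAt
  have hinj := hΨ.eventually_left_inverse
  have hlγ : HasStrictDerivAt (fun w => l (γ w)) 1 z := by
    have := l.hasStrictFDerivAt.comp_hasStrictDerivAt z hγ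
    rwa [hl] at this
  have hB : U ∩ {w | hΨ.localInverse _ _ _ (g (γ w), l (γ w)) = γ w} ∈ 𝓝 z :=
    Filter.inter_mem hU (hγ.hasDerivAt.continuousAt.eventually hinj)
  have himg := Filter.image_mem_map (m := fun w => l (γ w)) hB
  -- Since `l ∘ γ` is open at `z`, each nearby zero `y` of `g` has the same `l` as some `γ w`. Both
  -- points have image `(0, l y)` under `(g, l)`, hence coincide.
  rw [hlγ.map_nhds_eq one_ne_zero] at himg
  have hev := (l.continuous.continuousAt.eventually himg).and hinj
  obtain ⟨W, hW, hWo, hzW⟩ := eventually_nhds_iff.1 hev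
  refine ⟨W, hWo, hzW, fun y hy hgy => ?_⟩
  obtain ⟨⟨w, ⟨hwU, hwl⟩, hw⟩, hyl⟩ := hW y hy
  refine ⟨w, hwU, ?_⟩
  rw [← hyl, ← hwl, hzero w hwU, hgy]
  exact congrArg (fun c => hΨ.localInverse _ _ _ (0, c)) hw

variable {p : ℕ} {f : ℂ → Fin p → ℂ}

/-- The affine linear section: the points of `ℂ^p` whose image under the Segre embedding lies in
the linear span of the image of `f`. -/
def segreSection (f : ℂ → Fin p → ℂ) : Set (Fin p → ℂ) := {y | affineSegreVec y ∈ segreSpan f}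

theorem image_subset_segreSection : f '' unitDisk ⊆ segreSection f := by
  rintro _ ⟨z, hz, rfl⟩
  exact affineSegreVec_mem_segreSpan hz

theorem IsHolomorphicIsometry.deriv_ne_zero
    (hf : IsHolomorphicIsometry 2 unitDisk (polydisk p) f) {z : ℂ} (hz : z ∈ unitDisk) :
    deriv f z ≠ 0 := by
  intro h
  have h1 := hf.sum_norm_deriv_sq hz
  have hd := (hf.2.1.differentiableAt (isOpen_unitDisk.mem_nhds hz)).hasDerivAt
  have h2 : ∀ j, deriv (fun w => f w j) z = 0 := fun j => by
    rw [(hasDerivAt_pi.1 hd j).deriv, h]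
    rfl
  simp only [h2, norm_zero] at h1
  have hpos := one_sub_norm_sq_pos (show ‖z‖ < 1 from hz)
  have : 0 < 2 * (1 / (1 - ‖z‖ ^ 2) ^ 2) := by positivity
  rw [← h1] at this
  simp at this

/-- Every point of `f(Δ)` is a regular point of the linear section, which is locally `f(Δ)`. -/
theorem IsHolomorphicIsometry.exists_chart
    (hf : IsHolomorphicIsometry 2 unitDisk (polydisk p) f) {z : ℂ} (hz : z ∈ unitDisk) :
    ∃ (k : ℕ) (W : Set (Fin p → ℂ)) (g : (Fin p → ℂ) → Fin k → ℂ), IsOpen W ∧ f z ∈ W ∧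
      DifferentiableOn ℂ g W ∧ Function.Surjective (fderiv ℂ g (f z)) ∧
      (segreSection f ∩ polydisk p) ∩ W = {y ∈ W | g y = 0} ∧
      (segreSection f ∩ polydisk p) ∩ W ⊆ f '' unitDisk := by
  -- Only equations independent on the tangent directions at `f z` are kept, so they form a
  -- submersion there; a priori their zero set is larger than the section.
  obtain ⟨k, τ, hτM, hτs, hτk⟩ :=
    exists_linearMap_surjective_comp (affineSegreDeriv (f z)) (segreSpan f)
  have hder : ∀ y, HasStrictFDerivAt (fun y => τ (affineSegreVec y))
      (τ.toContinuousLinearMap.comp (affineSegreDeriv y).toContinuousLinearMap) y := fun y =>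
    τ.toContinuousLinearMap.hasStrictFDerivAt.comp y (hasStrictFDerivAt_affineSegreVec y)
  have hγ : HasStrictDerivAt f (deriv f z) z :=
    (hf.2.1.analyticAt (isOpen_unitDisk.mem_nhds hz)).hasStrictDerivAt
  have hzero : ∀ w ∈ unitDisk, τ (affineSegreVec (f w)) = 0 := fun w hw =>
    hτM _ (affineSegreVec_mem_segreSpan hw)
  have hγM : affineSegreDeriv (f z) (deriv f z) ∈ segreSpan f := by
    refine hτk _ ?_
    have h1 := (hder (f z)).hasFDerivAt.comp_hasDerivAt z hγ.hasDerivAt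
    exact h1.unique ((hasDerivAt_const z (0 : Fin k → ℂ)).congr_of_eventuallyEq
      (Filter.eventuallyEq_of_mem (isOpen_unitDisk.mem_nhds hz) hzero))
  have hne := hf.deriv_ne_zero hz
  obtain ⟨W, hWo, hzW, hW⟩ := exists_open_zeroSet_subset_image (isOpen_unitDisk.mem_nhds hz)
    (hder (f z)) hτs hγ hne hzero (fun v hv => by
      obtain ⟨a, b, hab, h⟩ := hf.exists_tangent_dependent (hf.1 hz)
        (affineSegreVec_mem_segreSpan hz) (hτk v hv) hγM
      have ha : a ≠ 0 := by
        rintro rfl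
        rcases hab with hab | hab
        · exact hab rfl
        · rw [zero_smul, zero_add, smul_eq_zero] at h
          exact h.elim hab hne
      refine ⟨-(a⁻¹ * b), ?_⟩
      rw [neg_smul, mul_smul, ← smul_neg, ← eq_neg_of_add_eq_zero_left h, smul_smul,
        inv_mul_cancel₀ ha, one_smul])
  refine ⟨k, W, fun y => τ (affineSegreVec y), hWo, hzW,
    fun y _ => (hder y).differentiableAt.differentiableWithinAt, ?_, ?_, ?_⟩
  · rw [(hder (f z)).hasFDerivAt.fderiv]
    exact hτs
  -- The kept equations suffice near `f z`: their zeros lie on `f(Δ)`, hence in the section.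
  · refine Subset.antisymm (fun y hy => ⟨hy.2, hτM _ hy.1.1⟩) fun y hy => ⟨?_, hy.1⟩
    have h := hW y hy.1 hy.2
    exact ⟨image_subset_segreSection h, hf.1.image_subset h⟩
  · exact fun y hy => hW y hy.2 (hτM _ hy.1.1)

/-- A holomorphic isometry is proper: its image is closed in the polydisk. -/
theorem IsHolomorphicIsometry.closure_image_inter
    (hf : IsHolomorphicIsometry 2 unitDisk (polydisk p) f) :
    closure (f '' unitDisk) ∩ polydisk p = f '' unitDisk := by
  refine Subset.antisymm ?_ (subset_inter subset_closure hf.1.image_subset)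
  rintro y ⟨hy, hyp⟩
  obtain ⟨x, hx, hxy⟩ := mem_closure_iff_seq_limit.1 hy
  choose ζ hζ hζx using hx
  obtain ⟨z, hz, φ, hφ, hlim⟩ := (isCompact_closedBall (0 : ℂ) 1).tendsto_subseq
    (x := ζ) fun n => by simpa using (show ‖ζ n‖ < 1 from hζ n).le
  have hlim' : Filter.Tendsto (fun n => f (ζ (φ n))) Filter.atTop (𝓝 y) := by
    simp only [hζx]
    exact hxy.comp hφ.tendsto_atTop
  have hz1 : ‖z‖ ≤ 1 := by simpa using hz
  rcases hz1.lt_or_eq with hz1 | hz1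
  · refine ⟨z, hz1, ?_⟩
    have hcont := (hf.2.1.differentiableAt (isOpen_unitDisk.mem_nhds hz1)).continuousAt
    exact tendsto_nhds_unique (hcont.tendsto.comp hlim) hlim'
  · exfalso
    obtain ⟨H, -, hH0, hH⟩ := hf.exists_segreForm_eq
    have h0 : (0 : ℂ) ∈ unitDisk := by simp [unitDisk]
    set C := ∏ _j : Fin p, (2 : ℝ) with hC
    -- Setting the second variable to `0` in the functional equation expresses `H(w) conj H(0)` as a
    -- product of `p` factors of modulus at most `2`.
    have hbound : ∀ w ∈ unitDisk, ‖H w‖ ≤ C / ‖H 0‖ := by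
      intro w hw
      have h := congrArg norm (hH w hw 0 h0)
      rw [segreForm_affineSegreVec, norm_prod] at h
      simp only [map_zero, mul_zero, sub_zero, one_pow, mul_one, norm_mul, RCLike.norm_conj] at h
      rw [le_div_iff₀ (norm_pos_iff.2 (hH0 0)), ← h]
      refine Finset.prod_le_prod (fun _ _ => norm_nonneg _) fun j _ => ?_
      refine (norm_sub_le _ _).trans ?_
      rw [norm_one, norm_mul, RCLike.norm_conj]
      have h1 := hf.1 hw j
      have h2 := hf.1 h0 j
      nlinarith [norm_nonneg (f w j), norm_nonneg (f 0 j)]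
    have hle : ∀ w ∈ unitDisk, ∏ j, (1 - ‖f w j‖ ^ 2) ≤
        (C / ‖H 0‖) ^ 2 * (1 - ‖w‖ ^ 2) ^ 2 := by
      intro w hw
      have h := hH w hw w hw
      rw [segreForm_affineSegreVec] at h
      have h1 : ∀ a : ℂ, a * conj a = ((‖a‖ ^ 2 : ℝ) : ℂ) := fun a => by
        rw [mul_comm, conj_mul_self_eq]
      simp only [h1] at h
      have h2 : ∏ j, (1 - ‖f w j‖ ^ 2) = ‖H w‖ ^ 2 * (1 - ‖w‖ ^ 2) ^ 2 := by
        exact_mod_cast h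
      rw [h2]
      gcongr
      exact hbound w hw
    have hcontL : Continuous fun v : Fin p → ℂ => ∏ j, (1 - ‖v j‖ ^ 2) := by fun_prop
    have hcontR : Continuous fun w : ℂ => (C / ‖H 0‖) ^ 2 * (1 - ‖w‖ ^ 2) ^ 2 := by fun_prop
    -- With `H` bounded, `|z| = 1` would force `∏ (1 - |y_j|²) ≤ 0`, which is impossible inside the
    -- polydisk.
    have hfin := le_of_tendsto_of_tendsto' ((hcontL.tendsto y).comp hlim')
      ((hcontR.tendsto z).comp hlim) fun n => hle _ (hζ (φ n))
    rw [hz1] at hfin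
    have hpos : 0 < ∏ j, (1 - ‖y j‖ ^ 2) :=
      Finset.prod_pos fun j _ => one_sub_norm_sq_pos (hyp j)
    norm_num at hfin
    exact absurd hpos (not_lt.2 hfin)

/-- The charts make `f(Δ)` consist of regular points and be open in the section; properness makes it
closed in the polydisk. Being connected, it is a whole component of the regular locus. -/
theorem IsHolomorphicIsometry.isIrreducibleComponent
    (hf : IsHolomorphicIsometry 2 unitDisk (polydisk p) f) :
    IsIrreducibleComponent (polydisk p) (segreSection f ∩ polydisk p) (f '' unitDisk) := by
  set A := segreSection f ∩ polydisk p with hA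
  have hreg : f '' unitDisk ⊆ regularLocus A := by
    rintro _ ⟨z, hz, rfl⟩
    obtain ⟨k, W, g, hWo, hzW, hg, hs, hAW, -⟩ := hf.exists_chart hz
    exact ⟨⟨image_subset_segreSection ⟨z, hz, rfl⟩, hf.1 hz⟩, k, W, g, hWo, hzW, hg, hs, hAW⟩
  have h0 : f 0 ∈ f '' unitDisk := ⟨0, by simp [unitDisk], rfl⟩
  refine ⟨f 0, hreg h0, ?_⟩
  suffices h : connectedComponentIn (regularLocus A) (f 0) = f '' unitDisk by
    rw [h, hf.closure_image_inter]
  refine Subset.antisymm ?_ ((isPreconnected_unitDisk.image f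
    hf.2.1.continuousOn).subset_connectedComponentIn h0 hreg)
  have hsub := connectedComponentIn_subset (regularLocus A) (f 0)
  have hsubA : connectedComponentIn (regularLocus A) (f 0) ⊆ A := fun y hy => (hsub hy).1
  set u := {y | ∃ W : Set (Fin p → ℂ), IsOpen W ∧ y ∈ W ∧ A ∩ W ⊆ f '' unitDisk} with hu
  have huo : IsOpen u := by
    rw [isOpen_iff_forall_mem_open]
    rintro y ⟨W, hWo, hyW, hW⟩
    exact ⟨W, fun x hx => ⟨W, hWo, hx, hW⟩, hWo, hyW⟩
  have hfu : f '' unitDisk ⊆ u := by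
    rintro _ ⟨z, hz, rfl⟩
    obtain ⟨k, W, g, hWo, hzW, -, -, -, hW⟩ := hf.exists_chart hz
    exact ⟨W, hWo, hzW, hW⟩
  have hAu : A ∩ u ⊆ f '' unitDisk := by
    rintro y ⟨hyA, W, -, hyW, hW⟩
    exact hW ⟨hyA, hyW⟩
  have hmem : f 0 ∈ connectedComponentIn (regularLocus A) (f 0) :=
    mem_connectedComponentIn (hreg h0)
  refine fun y hy => hAu ⟨hsubA hy, ?_⟩
  have hcl : ∀ x ∈ connectedComponentIn (regularLocus A) (f 0),
      x ∈ closure (f '' unitDisk) → x ∈ u := fun x hx hxc =>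
    hfu (hf.closure_image_inter.subset ⟨hxc, (hsubA hx).2⟩)
  by_contra hyu
  -- `u` and the complement of the closure of `f(Δ)` cover the component and are disjoint on it.
  obtain ⟨x, hx, hxu, hxv⟩ := isPreconnected_connectedComponentIn u (closure (f '' unitDisk))ᶜ huo
    isClosed_closure.isOpen_compl
    (fun x hx => (em (x ∈ closure (f '' unitDisk))).imp (hcl x hx) id)
    ⟨f 0, hmem, hfu h0⟩ ⟨y, hy, fun hyc => hyu (hcl y hy hyc)⟩
  exact hxv (subset_closure (hAu ⟨hsubA hx, hxu⟩))

/-- The span is the common kernel of the functionals vanishing on it, and each functional becomes a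
polynomial in `y` when composed with the lift. -/
theorem isAffineAlgebraic_segreSection (f : ℂ → Fin p → ℂ) :
    IsAffineAlgebraic (segreSection f) := by
  set P : Module.Dual ℂ ((Fin p → Fin 2) → ℂ) → MvPolynomial (Fin p) ℂ := fun l =>
    ∑ ε, MvPolynomial.C (l (Pi.single ε 1)) *
      ∏ j, (![1, MvPolynomial.X j] : Fin 2 → MvPolynomial (Fin p) ℂ) (ε j) with hP
  have heval : ∀ l y, MvPolynomial.aeval y (P l) = l (affineSegreVec y) := by
    intro l y
    have h1 : ∀ (j : Fin p) (e : Fin 2), MvPolynomial.aeval y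
        ((![1, MvPolynomial.X j] : Fin 2 → MvPolynomial (Fin p) ℂ) e) = ![1, y j] e := by
      intro j e
      fin_cases e <;> simp
    rw [LinearMap.pi_apply_eq_sum_univ l (affineSegreVec y)]
    simp only [hP, map_sum, map_mul, map_prod, h1, MvPolynomial.aeval_C, Algebra.algebraMap_self,
      RingHom.id_apply, smul_eq_mul]
    refine Finset.sum_congr rfl fun ε _ => ?_
    rw [mul_comm]
    congr 2
    funext i
    simp [Pi.single_apply, eq_comm]
  refine ⟨Ideal.span (P '' {l | ∀ x ∈ segreSpan f, l x = 0}), ?_⟩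
  rw [MvPolynomial.zeroLocus_span]
  ext y
  simp only [Set.mem_ofPred_eq, forall_mem_image, heval]
  refine ⟨fun hy l hl => hl _ hy, fun h => ?_⟩
  by_contra hy
  obtain ⟨l, hl, hle⟩ := Submodule.exists_le_ker_of_notMem (p := segreSpan f) hy
  exact hl (h fun x hx => hle hx)

theorem segreAffine_mem_projectivization_iff {y : Fin p → ℂ} :
    segreAffine y ∈ (segreSpan f).projectivization ↔ y ∈ segreSection f := by
  rw [segreAffine_eq_mk, Submodule.mk_mem_projectivization_iff]
  rfl

end LocalStructure

theorem proposition3p8 (p : ℕ) (hp : 2 ≤ p) (f : ℂ → Fin p → ℂ)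
    (hf : IsHolomorphicIsometry 2 unitDisk (polydisk p) f) :
    ∃ (V : Set (Fin p → ℂ)) (P : Projectivization.Subspace ℂ ((Fin p → Fin 2) → ℂ)),
      IsAffineAlgebraic V ∧
      IsIrreducibleComponent (polydisk p) (V ∩ polydisk p) (f '' unitDisk) ∧
      segreAffine '' (V ∩ polydisk p) = segreAffine '' polydisk p ∩ (P : Set _) := by
  refine ⟨segreSection f, (segreSpan f).projectivization, isAffineAlgebraic_segreSection f,
    hf.isIrreducibleComponent, Subset.antisymm ?_ ?_⟩
  · rintro _ ⟨y, ⟨hyV, hyp⟩, rfl⟩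
    exact ⟨⟨y, hyp, rfl⟩, segreAffine_mem_projectivization_iff.2 hyV⟩
  · rintro _ ⟨⟨y, hyp, rfl⟩, hyP⟩
    exact ⟨y, ⟨segreAffine_mem_projectivization_iff.1 hyP, hyp⟩, rfl⟩
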